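/- All graphs are finite and simple. A \emph{permutation graph} is the comparability graph of a poset of dimension at most two, where the dimension of a poset $(X,\prec)$ is the smallest $k$ such that $\prec$ is the intersection of $k$ total orders on $X$. A graph $G$ is \emph{$B_0$-VPG} if its vertices can be represented by simple paths without bends (that is, horizontal or vertical paths, possibly consisting of a single grid point) on the two-dimensional integer grid, such that two distinct vertices of $G$ are adjacent if and only if their paths share a grid point. An edge $xy$ of $G$ is a \emph{diamond diagonal} if there are two distinct non-adjacent vertices $a,b$ of $G$, each of them adjacent to both $x$ and $y$ (so that $x,a,y,b$ induce a diamond, i.e. a $C_4$ with one added diagonal, namely $xy$). Two vertices $x,y$ of $G$ are \emph{diamond related} if there is a path from $x$ to $y$ in $G$ all of whose edges are diamond diagonals. \textbf{Corollary.} A permutation graph $G$ is $B_0$-VPG if and only if no two distinct vertices of any induced $C_4$ in $G$ are diamond related. -/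

import Mathlib

/-- The comparability graph of a poset: two elements are adjacent iff one of them lies strictly
below the other. -/
def comparabilityGraph {V : Type*} (P : PartialOrder V) : SimpleGraph V where
  Adj x y := P.lt x y ∨ P.lt y x
  symm := ⟨fun _ _ h => h.symm⟩
  loopless := ⟨fun x h => h.elim (lt_irrefl x) (lt_irrefl x)⟩

/-- The strict order of `P` is the intersection of `k` total orders on the same set. -/
def IsIntersectionOfTotalOrders {V : Type*} (P : PartialOrder V) (k : ℕ) : Prop :=
  ∃ L : Fin k → LinearOrder V, ∀ x y : V, P.lt x y ↔ ∀ i : Fin k, (L i).lt x y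

/-- The dimension of the poset `P` (the smallest `k` such that the strict order is the
intersection of `k` total orders) is at most `d`. -/
def PosetDimLE {V : Type*} (P : PartialOrder V) (d : ℕ) : Prop :=
  ∃ k ≤ d, IsIntersectionOfTotalOrders P k

/-- A permutation graph is the comparability graph of a poset of dimension at most two. -/
def IsPermutationGraph {V : Type*} (G : SimpleGraph V) : Prop :=
  ∃ P : PartialOrder V, comparabilityGraph P = G ∧ PosetDimLE P 2

/-- The two-dimensional grid: the points of `ℤ × ℤ`, two of them being adjacent iff they are at
distance one on a common horizontal or vertical line. -/
noncomputable def gridGraph : SimpleGraph (ℤ × ℤ) :=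
  SimpleGraph.boxProd (SimpleGraph.hasse ℤ) (SimpleGraph.hasse ℤ)

/-- The number of bends of a grid path given by its list of vertices: the number of interior
vertices whose predecessor and successor lie neither on a common vertical line nor on a common
horizontal line. -/
def bendCount : List (ℤ × ℤ) → ℕ
  | a :: b :: c :: l =>
      (if a.1 ≠ c.1 ∧ a.2 ≠ c.2 then 1 else 0) + bendCount (b :: c :: l)
  | _ => 0

/-- `G` is a `B_k`-VPG graph: the vertices of `G` can be represented by simple paths with at most
`k` bends on the grid, such that two distinct vertices are adjacent iff their paths share a
vertex of the grid. -/
def IsBkVPG {V : Type*} (k : ℕ) (G : SimpleGraph V) : Prop :=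
  ∃ (s t : V → ℤ × ℤ) (p : ∀ v : V, gridGraph.Walk (s v) (t v)),
    (∀ v : V, (p v).IsPath ∧ bendCount (p v).support ≤ k) ∧
    ∀ u v : V, u ≠ v → (G.Adj u v ↔ ∃ z : ℤ × ℤ, z ∈ (p u).support ∧ z ∈ (p v).support)

/-- `x y` is a diamond diagonal of `G`: there are `a` and `b` such that `x, a, y, b` is a
four-cycle of `G`, and `G` has the edge `x y` but not the edge `a b`. So `x, a, y, b` induce a
diamond. -/
def IsDiamondDiagonal {V : Type*} (G : SimpleGraph V) (x y : V) : Prop :=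
  G.Adj x y ∧ ∃ a b : V, a ≠ b ∧ ¬ G.Adj a b ∧
    G.Adj x a ∧ G.Adj a y ∧ G.Adj y b ∧ G.Adj b x

/-- The spanning subgraph of `G` whose edges are the diamond diagonals of `G`. -/
def diamondDiagonalGraph {V : Type*} (G : SimpleGraph V) : SimpleGraph V where
  Adj x y := IsDiamondDiagonal G x y
  symm := ⟨fun _ _ ⟨h, a, b, hab, hn, h1, h2, h3, h4⟩ =>
    ⟨h.symm, a, b, hab, hn, h2.symm, h1.symm, h4.symm, h3.symm⟩⟩
  loopless := ⟨fun x h => G.loopless.irrefl x h.1⟩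

/-- Two vertices are diamond related in `G` if some path of `G` between them consists of diamond
diagonals only. -/
def DiamondRelated {V : Type*} (G : SimpleGraph V) (x y : V) : Prop :=
  (diamondDiagonalGraph G).Reachable x y

/-! A path without bends is a segment, so the question is which graphs are intersection graphs of
horizontal and vertical segments. If `x y` is a diamond diagonal, then by the Helly property of
boxes two disjoint segments both meet the intersection of `x` and `y`; so this intersection has more
than one point, and `x`, `y` are collinear. Diamond related vertices therefore share a line, whereas
no two segments of an induced `C₄` do. This half holds for every graph.

Conversely, a permutation graph is the comparability graph of an order `Q` and the incomparability
graph of an order `P`. It suffices to colour the vertices by two directions so that colours differ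
along edges of induced four-cycles and agree along diamond diagonals.

Such a colouring exists (`exists_isDirectionColouring`): otherwise some closed walk along these
constrained edges has an odd number of square edges. A shortest one has no constrained chord. By
means of `P` its vertices form a clique (`adj_of_minimal`), hence a chain of `Q`. There square edges
extend upwards and downwards, so the least and greatest vertices span a square edge and are
consecutive, which the next edges of the walk contradict (`false_of_clique`).

The colouring yields segments (`hasSegmentRep`): each component of the graph of monochromatic edges
becomes a line, and `P` orders the parallel lines. By `adj_of_touch`, vertices of different colours
are adjacent as soon as each has a neighbour on the other's line, so the segment of a vertex only
has to cross exactly the lines on which it has neighbours. -/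

/-- `G` is the intersection graph of horizontal and vertical segments, given as integer boxes
`[l, r] × [b, t]` which are degenerate in one of the two directions. -/
def HasSegmentRep {V : Type*} (G : SimpleGraph V) : Prop :=
  ∃ l r b t : V → ℤ, (∀ v, l v ≤ r v ∧ b v ≤ t v ∧ (l v = r v ∨ b v = t v)) ∧
    ∀ u v, u ≠ v → (G.Adj u v ↔ l u ≤ r v ∧ l v ≤ r u ∧ b u ≤ t v ∧ b v ≤ t u)

/-! ### Grid paths without bends as segments -/

theorem gridGraph_adj_iff {x y : ℤ × ℤ} : gridGraph.Adj x y ↔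
    (x.2 = y.2 ∧ (x.1 + 1 = y.1 ∨ y.1 + 1 = x.1)) ∨
      (x.1 = y.1 ∧ (x.2 + 1 = y.2 ∨ y.2 + 1 = x.2)) := by
  simp only [gridGraph, SimpleGraph.boxProd_adj, SimpleGraph.hasse_adj, Order.covBy_iff_add_one_eq]
  tauto

theorem bendCount_eq_zero_of_line (l : List (ℤ × ℤ))
    (h : (∃ x, ∀ z ∈ l, z.1 = x) ∨ ∃ y, ∀ z ∈ l, z.2 = y) : bendCount l = 0 := by
  induction l with
  | nil => rfl
  | cons a l ih =>
    match l, ih, h with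
    | [], _, _ => rfl
    | [b], _, _ => rfl
    | b :: c :: l, ih, h =>
      have h1 : bendCount (b :: c :: l) = 0 := by
        apply ih
        rcases h with ⟨x, h⟩ | ⟨y, h⟩
        · exact Or.inl ⟨x, fun z hz => h z (List.mem_cons_of_mem _ hz)⟩
        · exact Or.inr ⟨y, fun z hz => h z (List.mem_cons_of_mem _ hz)⟩
      have h2 : ¬ (a.1 ≠ c.1 ∧ a.2 ≠ c.2) := by
        rcases h with ⟨x, h⟩ | ⟨y, h⟩
        · have ha := h a (by simp)
          have hc := h c (by simp)
          exact fun hh => hh.1 (ha.trans hc.symm)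
        · have ha := h a (by simp)
          have hc := h c (by simp)
          exact fun hh => hh.2 (ha.trans hc.symm)
      rw [bendCount, if_neg h2, h1]

/-- Grid neighbours differ in exactly one coordinate. If `b` and `c` agree in one coordinate, they
differ in the other, so absence of a bend at `b` forces `a` onto the line of `b` and `c`. -/
theorem line_of_bendCount_eq_zero (l : List (ℤ × ℤ)) (hc : l.IsChain gridGraph.Adj)
    (h : bendCount l = 0) : (∃ x, ∀ z ∈ l, z.1 = x) ∨ ∃ y, ∀ z ∈ l, z.2 = y := by
  induction l with
  | nil => simp
  | cons a l ih =>
    match l, ih, hc, h with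
    | [], _, _, _ => exact Or.inl ⟨a.1, by simp⟩
    | [b], _, hc, _ =>
      have hab := gridGraph_adj_iff.1 (by simpa using hc)
      rcases hab with hab | hab
      · exact Or.inr ⟨a.2, by simp [hab.1]⟩
      · exact Or.inl ⟨a.1, by simp [hab.1]⟩
    | b :: c :: l, ih, hc, h =>
      rw [List.isChain_cons_cons] at hc
      have hab := gridGraph_adj_iff.1 hc.1
      have hbc := gridGraph_adj_iff.1 (List.isChain_cons_cons.1 hc.2).1
      rw [bendCount] at h
      have h2 : ¬ (a.1 ≠ c.1 ∧ a.2 ≠ c.2) := by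
        intro hh
        rw [if_pos hh] at h
        omega
      rcases ih hc.2 (by omega) with ⟨x, hx⟩ | ⟨y, hy⟩
      · left
        have hb := hx b (by simp)
        have hc' := hx c (by simp)
        refine ⟨x, fun z hz => ?_⟩
        rcases List.mem_cons.1 hz with rfl | hz
        · omega
        · exact hx z hz
      · right
        have hb := hy b (by simp)
        have hc' := hy c (by simp)
        refine ⟨y, fun z hz => ?_⟩
        rcases List.mem_cons.1 hz with rfl | hz
        · omega
        · exact hy z hz

/-- A discrete intermediate value property: each step changes a coordinate by at most one, so the
values taken form an interval. -/
theorem exists_proj_support_fst {s t : ℤ × ℤ} (p : gridGraph.Walk s t) :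
    ∃ lo hi : ℤ, ∀ x, (∃ z ∈ p.support, z.1 = x) ↔ lo ≤ x ∧ x ≤ hi := by
  induction p with
  | nil => exact ⟨_, _, fun x => by simp; exact le_antisymm_iff⟩
  | @cons u v w h p ih =>
    obtain ⟨lo, hi, ih⟩ := ih
    have hv := (ih v.1).1 ⟨v, p.start_mem_support, rfl⟩
    have huv := gridGraph_adj_iff.1 h
    refine ⟨min lo u.1, max hi u.1, fun x => ?_⟩
    simp only [SimpleGraph.Walk.support_cons, List.mem_cons, exists_eq_or_imp, ih]
    omega

theorem exists_proj_support_snd {s t : ℤ × ℤ} (p : gridGraph.Walk s t) :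
    ∃ lo hi : ℤ, ∀ x, (∃ z ∈ p.support, z.2 = x) ↔ lo ≤ x ∧ x ≤ hi := by
  induction p with
  | nil => exact ⟨_, _, fun x => by simp; exact le_antisymm_iff⟩
  | @cons u v w h p ih =>
    obtain ⟨lo, hi, ih⟩ := ih
    have hv := (ih v.2).1 ⟨v, p.start_mem_support, rfl⟩
    have huv := gridGraph_adj_iff.1 h
    refine ⟨min lo u.2, max hi u.2, fun x => ?_⟩
    simp only [SimpleGraph.Walk.support_cons, List.mem_cons, exists_eq_or_imp, ih]
    omega

/-- The support of a path without bends is a segment. -/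
theorem exists_box_of_straight {s t : ℤ × ℤ} (p : gridGraph.Walk s t)
    (h : bendCount p.support = 0) :
    ∃ l r b t : ℤ, (l ≤ r ∧ b ≤ t ∧ (l = r ∨ b = t)) ∧
      ∀ z : ℤ × ℤ, z ∈ p.support ↔ (l ≤ z.1 ∧ z.1 ≤ r) ∧ (b ≤ z.2 ∧ z.2 ≤ t) := by
  have hs := p.start_mem_support
  rcases line_of_bendCount_eq_zero _ p.isChain_adj_support h with ⟨x, hx⟩ | ⟨y, hy⟩
  · obtain ⟨lo, hi, hp⟩ := exists_proj_support_snd p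
    have hs' := (hp s.2).1 ⟨s, hs, rfl⟩
    refine ⟨x, x, lo, hi, ⟨le_rfl, by omega, Or.inl rfl⟩, fun z => ⟨fun hz => ?_, fun hz => ?_⟩⟩
    · exact ⟨⟨(hx z hz).ge, (hx z hz).le⟩, (hp z.2).1 ⟨z, hz, rfl⟩⟩
    · obtain ⟨w, hw, hwz⟩ := (hp z.2).2 hz.2
      have : w = z := Prod.ext (by have := hx w hw; omega) hwz
      exact this ▸ hw
  · obtain ⟨lo, hi, hp⟩ := exists_proj_support_fst p
    have hs' := (hp s.1).1 ⟨s, hs, rfl⟩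
    refine ⟨lo, hi, y, y, ⟨by omega, le_rfl, Or.inr rfl⟩, fun z => ⟨fun hz => ?_, fun hz => ?_⟩⟩
    · exact ⟨(hp z.1).1 ⟨z, hz, rfl⟩, ⟨(hy z hz).ge, (hy z hz).le⟩⟩
    · obtain ⟨w, hw, hwz⟩ := (hp z.1).2 hz.1
      have : w = z := Prod.ext hwz (by have := hy w hw; omega)
      exact this ▸ hw

theorem exists_horizontal_path (x y : ℤ) (n : ℕ) :
    ∃ (t : ℤ × ℤ) (p : gridGraph.Walk (x, y) t), p.IsPath ∧
      ∀ z : ℤ × ℤ, z ∈ p.support ↔ (x ≤ z.1 ∧ z.1 ≤ x + n) ∧ z.2 = y := by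
  induction n generalizing x with
  | zero =>
    refine ⟨_, .nil, .nil, fun z => ?_⟩
    simp [Prod.ext_iff]
    omega
  | succ n ih =>
    obtain ⟨t, p, hp, hz⟩ := ih (x + 1)
    refine ⟨t, .cons (gridGraph_adj_iff.2 (by simp)) p, ?_, fun z => ?_⟩
    · rw [SimpleGraph.Walk.cons_isPath_iff, hz]
      exact ⟨hp, by simp⟩
    · simp only [SimpleGraph.Walk.support_cons, List.mem_cons, hz, Prod.ext_iff]
      push_cast
      omega

theorem exists_vertical_path (x y : ℤ) (n : ℕ) :
    ∃ (t : ℤ × ℤ) (p : gridGraph.Walk (x, y) t), p.IsPath ∧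
      ∀ z : ℤ × ℤ, z ∈ p.support ↔ z.1 = x ∧ (y ≤ z.2 ∧ z.2 ≤ y + n) := by
  induction n generalizing y with
  | zero =>
    refine ⟨_, .nil, .nil, fun z => ?_⟩
    simp [Prod.ext_iff]
    omega
  | succ n ih =>
    obtain ⟨t, p, hp, hz⟩ := ih (y + 1)
    refine ⟨t, .cons (gridGraph_adj_iff.2 (by simp)) p, ?_, fun z => ?_⟩
    · rw [SimpleGraph.Walk.cons_isPath_iff, hz]
      exact ⟨hp, by simp⟩
    · simp only [SimpleGraph.Walk.support_cons, List.mem_cons, hz, Prod.ext_iff]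
      push_cast
      omega

theorem exists_straight_of_box (l r b t : ℤ) (h : l ≤ r ∧ b ≤ t ∧ (l = r ∨ b = t)) :
    ∃ (s e : ℤ × ℤ) (p : gridGraph.Walk s e), (p.IsPath ∧ bendCount p.support ≤ 0) ∧
      ∀ z : ℤ × ℤ, z ∈ p.support ↔ (l ≤ z.1 ∧ z.1 ≤ r) ∧ (b ≤ z.2 ∧ z.2 ≤ t) := by
  obtain ⟨h1, h2, rfl | rfl⟩ := h
  · obtain ⟨e, p, hp, hz⟩ := exists_vertical_path l b (t - b).toNat
    refine ⟨_, e, p, ⟨hp, (bendCount_eq_zero_of_line _ (Or.inl ⟨l, fun z h => ?_⟩)).le⟩,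
      fun z => ?_⟩
    · exact ((hz z).1 h).1
    · rw [hz]
      omega
  · obtain ⟨e, p, hp, hz⟩ := exists_horizontal_path l b (r - l).toNat
    refine ⟨_, e, p, ⟨hp, (bendCount_eq_zero_of_line _ (Or.inr ⟨b, fun z h => ?_⟩)).le⟩,
      fun z => ?_⟩
    · exact ((hz z).1 h).2
    · rw [hz]
      omega

theorem exists_mem_boxes_iff {l r b t l' r' b' t' : ℤ} (h : l ≤ r ∧ b ≤ t)
    (h' : l' ≤ r' ∧ b' ≤ t') :
    (∃ z : ℤ × ℤ, ((l ≤ z.1 ∧ z.1 ≤ r) ∧ (b ≤ z.2 ∧ z.2 ≤ t)) ∧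
      ((l' ≤ z.1 ∧ z.1 ≤ r') ∧ (b' ≤ z.2 ∧ z.2 ≤ t'))) ↔
      l ≤ r' ∧ l' ≤ r ∧ b ≤ t' ∧ b' ≤ t := by
  constructor
  · rintro ⟨z, hz⟩
    omega
  · intro hh
    refine ⟨(max l l', max b b'), ?_⟩
    dsimp only
    omega

theorem isBkVPG_zero_iff_hasSegmentRep {V : Type*} (G : SimpleGraph V) :
    IsBkVPG 0 G ↔ HasSegmentRep G := by
  constructor
  · rintro ⟨s, e, p, hp, hadj⟩
    choose l r b t hbox hmem using
      fun v => exists_box_of_straight (p v) (Nat.le_zero.1 (hp v).2)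
    refine ⟨l, r, b, t, hbox, fun u v huv => ?_⟩
    rw [hadj u v huv]
    simp only [hmem]
    exact exists_mem_boxes_iff ⟨(hbox u).1, (hbox u).2.1⟩ ⟨(hbox v).1, (hbox v).2.1⟩
  · rintro ⟨l, r, b, t, hbox, hadj⟩
    choose s e p hp hmem using fun v => exists_straight_of_box (l v) (r v) (b v) (t v) (hbox v)
    refine ⟨s, e, p, hp, fun u v huv => ?_⟩
    rw [hadj u v huv]
    simp only [hmem]
    exact (exists_mem_boxes_iff ⟨(hbox u).1, (hbox u).2.1⟩ ⟨(hbox v).1, (hbox v).2.1⟩).symm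

/-! ### Induced four-cycles -/

/-- The vertices `x, y, z, w` induce a four-cycle, in this cyclic order. -/
structure InducesSquare {V : Type*} (G : SimpleGraph V) (x y z w : V) : Prop where
  adj₁ : G.Adj x y
  adj₂ : G.Adj y z
  adj₃ : G.Adj z w
  adj₄ : G.Adj w x
  ne₁ : x ≠ z
  ne₂ : y ≠ w
  not_adj₁ : ¬ G.Adj x z
  not_adj₂ : ¬ G.Adj y w

namespace InducesSquare

variable {V : Type*} {G : SimpleGraph V} {x y z w : V}

theorem rotate (h : InducesSquare G x y z w) : InducesSquare G y z w x :=
  ⟨h.adj₂, h.adj₃, h.adj₄, h.adj₁, h.ne₂, h.ne₁.symm, h.not_adj₂, fun e => h.not_adj₁ e.symm⟩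

theorem reverse (h : InducesSquare G x y z w) : InducesSquare G y x w z :=
  ⟨h.adj₁.symm, h.adj₄.symm, h.adj₃.symm, h.adj₂.symm, h.ne₂, h.ne₁, h.not_adj₂, h.not_adj₁⟩

theorem of_embedding (c : SimpleGraph.cycleGraph 4 ↪g G) :
    InducesSquare G (c 0) (c 1) (c 2) (c 3) where
  adj₁ := c.map_adj_iff.2 (by decide)
  adj₂ := c.map_adj_iff.2 (by decide)
  adj₃ := c.map_adj_iff.2 (by decide)
  adj₄ := c.map_adj_iff.2 (by decide)
  ne₁ := c.injective.ne (by decide)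
  ne₂ := c.injective.ne (by decide)
  not_adj₁ := fun h => absurd (c.map_adj_iff.1 h) (by decide)
  not_adj₂ := fun h => absurd (c.map_adj_iff.1 h) (by decide)

theorem exists_embedding (h : InducesSquare G x y z w) :
    ∃ c : SimpleGraph.cycleGraph 4 ↪g G, c 0 = x ∧ c 1 = y ∧ c 2 = z ∧ c 3 = w := by
  have d1 := h.adj₁.ne
  have d2 := h.adj₂.ne
  have d3 := h.adj₃.ne
  have d4 := h.adj₄.ne
  have d5 := h.ne₁
  have d6 := h.ne₂
  refine ⟨⟨⟨![x, y, z, w], ?_⟩, ?_⟩, rfl, rfl, rfl, rfl⟩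
  · intro i j hij
    fin_cases i <;> fin_cases j <;> first | rfl | (simp at hij; simp_all)
  · intro i j
    have e1 := h.adj₁
    have e2 := h.adj₂
    have e3 := h.adj₃
    have e4 := h.adj₄
    have e5 := h.not_adj₁
    have e6 := h.not_adj₂
    have e7 := fun e : G.Adj z x => h.not_adj₁ e.symm
    have e8 := fun e : G.Adj w y => h.not_adj₂ e.symm
    have e0 := fun v : V => G.irrefl (v := v)
    fin_cases i <;> fin_cases j <;>
      first
      | exact iff_of_true e1 (by decide)
      | exact iff_of_true e2 (by decide)
      | exact iff_of_true e3 (by decide)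
      | exact iff_of_true e4 (by decide)
      | exact iff_of_true e1.symm (by decide)
      | exact iff_of_true e2.symm (by decide)
      | exact iff_of_true e3.symm (by decide)
      | exact iff_of_true e4.symm (by decide)
      | exact iff_of_false e5 (by decide)
      | exact iff_of_false e6 (by decide)
      | exact iff_of_false e7 (by decide)
      | exact iff_of_false e8 (by decide)
      | exact iff_of_false (e0 _) (by decide)

end InducesSquare

/-! ### Necessity: collinearity of diamond related segments -/

/-- Two nondegenerate segments on a common line. -/
def SegmentsCollinear {V : Type*} (l r b t : V → ℤ) (x y : V) : Prop :=
  (l x < r x ∧ l y < r y ∧ b x = b y) ∨ (b x < t x ∧ b y < t y ∧ l x = l y)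

/-- The middle segment is nondegenerate, so it has only one direction and both collinearities refer
to the same line. -/
theorem SegmentsCollinear.trans {V : Type*} {l r b t : V → ℤ}
    (hbox : ∀ v, l v ≤ r v ∧ b v ≤ t v ∧ (l v = r v ∨ b v = t v)) {x y z : V}
    (h : SegmentsCollinear l r b t x y) (h' : SegmentsCollinear l r b t y z) :
    SegmentsCollinear l r b t x z := by
  have := hbox y
  unfold SegmentsCollinear at *
  omega

/-- Pairwise intersecting boxes have a common point. If `x` and `y` shared just one point, both `p`
and `q` would contain it and so be adjacent. Hence the overlap is a nondegenerate segment. -/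
theorem segmentsCollinear_of_isDiamondDiagonal {V : Type*} {G : SimpleGraph V} {l r b t : V → ℤ}
    (hbox : ∀ v, l v ≤ r v ∧ b v ≤ t v ∧ (l v = r v ∨ b v = t v))
    (hadj : ∀ u v, u ≠ v → (G.Adj u v ↔ l u ≤ r v ∧ l v ≤ r u ∧ b u ≤ t v ∧ b v ≤ t u))
    {x y : V} (h : IsDiamondDiagonal G x y) : SegmentsCollinear l r b t x y := by
  obtain ⟨hxy, p, q, hpq, hn, h1, h2, h3, h4⟩ := h
  have e1 := (hadj _ _ h1.ne).1 h1
  have e2 := (hadj _ _ h2.ne).1 h2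
  have e3 := (hadj _ _ h3.ne).1 h3
  have e4 := (hadj _ _ h4.ne).1 h4
  have e5 := (hadj _ _ hxy.ne).1 hxy
  rw [hadj _ _ hpq] at hn
  have b1 := hbox x
  have b2 := hbox y
  have b3 := hbox p
  have b4 := hbox q
  unfold SegmentsCollinear
  omega

/-- The case `x = y` is excluded because collinearity is not reflexive: a single point is not
collinear with itself. -/
theorem segmentsCollinear_of_diamondRelated {V : Type*} {G : SimpleGraph V} {l r b t : V → ℤ}
    (hbox : ∀ v, l v ≤ r v ∧ b v ≤ t v ∧ (l v = r v ∨ b v = t v))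
    (hadj : ∀ u v, u ≠ v → (G.Adj u v ↔ l u ≤ r v ∧ l v ≤ r u ∧ b u ≤ t v ∧ b v ≤ t u))
    {x y : V} (h : DiamondRelated G x y) (hxy : x ≠ y) : SegmentsCollinear l r b t x y := by
  obtain ⟨p⟩ := h
  induction p with
  | nil => exact absurd rfl hxy
  | @cons u v w huv p ih =>
    have h1 := segmentsCollinear_of_isDiamondDiagonal hbox hadj huv
    by_cases hvw : v = w
    · exact hvw ▸ h1
    · exact h1.trans hbox (ih hvw)

/-- If `x`, `y` shared a line, `w` and `z` would meet it on opposite sides of the overlap of `x` and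
`y`, and could not meet each other. If the disjoint `x`, `z` shared a line, both `y` and `w` would
cover the gap between them, and so would meet. -/
theorem InducesSquare.not_segmentsCollinear {V : Type*} {G : SimpleGraph V} {l r b t : V → ℤ}
    (hbox : ∀ v, l v ≤ r v ∧ b v ≤ t v ∧ (l v = r v ∨ b v = t v))
    (hadj : ∀ u v, u ≠ v → (G.Adj u v ↔ l u ≤ r v ∧ l v ≤ r u ∧ b u ≤ t v ∧ b v ≤ t u))
    {x y z w : V} (h : InducesSquare G x y z w) :
    ¬ SegmentsCollinear l r b t x y ∧ ¬ SegmentsCollinear l r b t x z := by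
  obtain ⟨h1, h2, h3, h4, n1, n2, h5, h6⟩ := h
  have e1 := (hadj _ _ h1.ne).1 h1
  have e2 := (hadj _ _ h2.ne).1 h2
  have e3 := (hadj _ _ h3.ne).1 h3
  have e4 := (hadj _ _ h4.ne).1 h4
  rw [hadj _ _ n1] at h5
  rw [hadj _ _ n2] at h6
  have b1 := hbox x
  have b2 := hbox y
  have b3 := hbox z
  have b4 := hbox w
  unfold SegmentsCollinear
  constructor <;> omega

/-- In an intersection graph of segments, no two vertices of an induced four-cycle are diamond
related. -/
theorem InducesSquare.not_diamondRelated {V : Type*} {G : SimpleGraph V} (hG : HasSegmentRep G)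
    {x y z w : V} (h : InducesSquare G x y z w) :
    ¬ DiamondRelated G x y ∧ ¬ DiamondRelated G x z := by
  obtain ⟨l, r, b, t, hbox, hadj⟩ := hG
  exact ⟨fun hd => (h.not_segmentsCollinear hbox hadj).1
      (segmentsCollinear_of_diamondRelated hbox hadj hd h.adj₁.ne),
    fun hd => (h.not_segmentsCollinear hbox hadj).2
      (segmentsCollinear_of_diamondRelated hbox hadj hd h.ne₁)⟩

/-- The condition on embedded four-cycles, in terms of side and diagonal pairs. -/
theorem forall_cycleGraph_embedding_iff {V : Type*} (G : SimpleGraph V) :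
    (∀ (c : SimpleGraph.cycleGraph 4 ↪g G) (i j : Fin 4), i ≠ j →
        ¬ DiamondRelated G (c i) (c j)) ↔
      ∀ x y z w, InducesSquare G x y z w → ¬ DiamondRelated G x y ∧ ¬ DiamondRelated G x z := by
  constructor
  · intro H x y z w h
    obtain ⟨c, rfl, rfl, rfl, rfl⟩ := h.exists_embedding
    exact ⟨H c 0 1 (by decide), H c 0 2 (by decide)⟩
  · intro H c i j hij
    have h := InducesSquare.of_embedding c
    have key : ∀ i j : Fin 4, i < j → ¬ DiamondRelated G (c i) (c j) := by
      have h1 := H _ _ _ _ h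
      have h2 := H _ _ _ _ h.rotate
      have h3 := H _ _ _ _ h.rotate.rotate
      have h4 := H _ _ _ _ h.rotate.rotate.rotate
      have h5 : ¬ DiamondRelated G (c 0) (c 3) := fun e => h4.1 e.symm
      intro i j hij
      fin_cases i <;> fin_cases j <;> first | exact absurd hij (by decide) | skip
      exacts [h1.1, h1.2, h5, h2.1, h2.2, h3.1]
    rcases lt_or_gt_of_ne hij with h | h
    · exact key i j h
    · exact fun e => key j i h e.symm

/-! ### Direction colourings of incomparability graphs -/

/-- `G` is the incomparability graph of the partial order on its vertices. -/
def IsIncomparabilityGraph {V : Type*} [PartialOrder V] (G : SimpleGraph V) : Prop :=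
  ∀ x y, G.Adj x y ↔ ¬ x ≤ y ∧ ¬ y ≤ x

/-- The edges of `G` whose ends have the same colour. -/
def monochromaticGraph {V : Type*} (G : SimpleGraph V) (f : V → Bool) : SimpleGraph V where
  Adj x y := G.Adj x y ∧ f x = f y
  symm := ⟨fun _ _ h => ⟨h.1.symm, h.2.symm⟩⟩
  loopless := ⟨fun x h => G.loopless.irrefl x h.1⟩

theorem SimpleGraph.Reachable.exists_boundary {V : Type*} {G : SimpleGraph V} {u v : V}
    (h : G.Reachable u v) (p : V → Prop) (hu : p u) (hv : ¬ p v) :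
    ∃ s t, G.Reachable u s ∧ G.Adj s t ∧ p s ∧ ¬ p t := by
  classical
  obtain ⟨w⟩ := h
  obtain ⟨d, hd, h1, h2⟩ := w.exists_boundary_dart {x | p x} hu hv
  exact ⟨d.fst, d.snd, ⟨w.takeUntil _ (w.dart_fst_mem_support_of_mem_darts hd)⟩, d.adj, h1, h2⟩

/-- A vertex colouring by two colours (horizontal and vertical) which separates the ends of the
edges of induced four-cycles and does not separate the ends of diamond diagonals. -/
structure IsDirectionColouring {V : Type*} (G : SimpleGraph V) (f : V → Bool) : Prop where
  square : ∀ {x y z w}, InducesSquare G x y z w → f x ≠ f y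
  diamond : ∀ {x y}, IsDiamondDiagonal G x y → f x = f y

namespace IsDirectionColouring

variable {V : Type*} {G : SimpleGraph V} {f : V → Bool}

theorem eq_of_reachable {x y : V} (h : (monochromaticGraph G f).Reachable x y) : f x = f y := by
  obtain ⟨p⟩ := h
  induction p with
  | nil => rfl
  | cons h _ ih => exact h.2.trans ih

variable [PartialOrder V]

/-- Two chains with no comparabilities across (a 2+2) induce the square `a, c, b, d`, on which the
colours alternate. -/
theorem false_of_two_add_two (hG : IsIncomparabilityGraph G) (hf : IsDirectionColouring G f)
    {a b c d : V} (hab : a < b) (hcd : c < d) (h1 : G.Adj a c) (h2 : G.Adj c b) (h3 : G.Adj b d)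
    (h4 : G.Adj d a) (h : f a = f c ∨ f c = f b ∨ f b = f d ∨ f d = f a) : False := by
  have hs : InducesSquare G a c b d := ⟨h1, h2, h3, h4, hab.ne, hcd.ne,
    fun e => ((hG _ _).1 e).1 hab.le, fun e => ((hG _ _).1 e).1 hcd.le⟩
  rcases h with h | h | h | h
  exacts [hf.square hs h, hf.square hs.rotate h, hf.square hs.rotate.rotate h,
    hf.square hs.rotate.rotate.rotate h]

/-- If `s` and `c` are adjacent, `s c` is a diamond diagonal with differently coloured ends; if not,
`r, s, r', c` is a square with the monochromatic edge `r s`. -/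
theorem false_of_common_neighbours (hG : IsIncomparabilityGraph G) (hf : IsDirectionColouring G f)
    {r r' s c : V} (hr : r < r') (h1 : G.Adj r s) (h2 : G.Adj s r') (h3 : G.Adj r c)
    (h4 : G.Adj c r') (hs : f s = f r) (hc : f c ≠ f r) : False := by
  have hn : ¬ G.Adj r r' := fun e => ((hG _ _).1 e).1 hr.le
  by_cases h : G.Adj s c
  · exact hc ((hf.diamond ⟨h, r, r', hr.ne, hn, h1.symm, h3, h4, h2.symm⟩).symm.trans hs)
  · exact hf.square (⟨h1, h2, h4.symm, h3.symm, hr.ne, fun e => hc (e ▸ hs), hn, h⟩ :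
      InducesSquare G r s r' c) hs.symm

theorem adj_or_lt (hG : IsIncomparabilityGraph G) {x y : V} (h : x ≠ y) :
    G.Adj x y ∨ x < y ∨ y < x := by
  rw [hG]
  by_cases h1 : x ≤ y
  · exact Or.inr (Or.inl (lt_of_le_of_ne h1 h))
  · by_cases h2 : y ≤ x
    · exact Or.inr (Or.inr (lt_of_le_of_ne h2 h.symm))
    · exact Or.inl ⟨h1, h2⟩

/-- The neighbours of `c` in a component of the other colour form a clique. -/
theorem false_of_adj_of_lt (hG : IsIncomparabilityGraph G) (hf : IsDirectionColouring G f)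
    {r r' c : V} (h : (monochromaticGraph G f).Reachable r r') (hr : r < r') (h1 : G.Adj r c)
    (h2 : G.Adj c r') (hc : f c ≠ f r) : False := by
  -- The monochromatic path from `r` to `r'` has an edge `s t` entering the set above `r`. Unless `r
  -- < t` or `r < r'` has the common neighbours `s` and `c`, the chains `s < r'` and `c < t` form a
  -- 2+2 containing the monochromatic edge `s t`.
  obtain ⟨s, t, hs, hst, h3, h4⟩ := h.exists_boundary (fun z => ¬ r < z) (lt_irrefl r) (by simpa)
  have hfr := eq_of_reachable h
  have hfs := eq_of_reachable hs
  have hft := hst.2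
  have ast := (hG _ _).1 hst.1
  have arc := (hG _ _).1 h1
  have acr := (hG _ _).1 h2
  simp only [not_not] at h3 h4
  have k1 : G.Adj r s := (hG _ _).2 (by grind [lt_or_eq_of_le])
  by_cases k2 : G.Adj t c
  · exact false_of_common_neighbours hG hf h4 k1 hst.1 h1 k2.symm hfs.symm hc
  rw [hG] at k2
  have htc : c < t := by grind [lt_or_eq_of_le]
  by_cases k3 : G.Adj s r'
  · exact false_of_common_neighbours hG hf hr k1 k3 h1 h2 hfs.symm hc
  rw [hG] at k3
  have hsr : s < r' := by grind [lt_or_eq_of_le]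
  exact false_of_two_add_two hG hf hsr htc ((hG _ _).2 (by grind [lt_or_eq_of_le])) h2
    ((hG _ _).2 (by grind [lt_or_eq_of_le]))
    hst.1.symm (by grind [lt_or_eq_of_le])

/-- The case of `adj_of_touch` with paths of length one. If `r₁`, `c₁` are adjacent they form a
diamond diagonal over `r`, `c`; if they are comparable, a square with the monochromatic edge `r r₁`
arises. -/
theorem false_of_local (hG : IsIncomparabilityGraph G) (hf : IsDirectionColouring G f)
    {r c r₁ c₁ : V} (hrc : r < c) (h1 : G.Adj r r₁) (h2 : G.Adj c c₁) (h3 : G.Adj r c₁)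
    (h4 : G.Adj r₁ c) (hr : f r = f r₁) (hc : f c = f c₁) (h : f r ≠ f c) : False := by
  by_cases k : G.Adj r₁ c₁
  · have := hf.diamond (x := r₁) (y := c₁)
      ⟨k, r, c, hrc.ne, fun e => ((hG _ _).1 e).1 hrc.le, h1.symm, h3, h2.symm, h4.symm⟩
    exact h (by rw [hr, hc, this])
  · rcases adj_or_lt hG (x := r₁) (y := c₁) (by grind [lt_or_eq_of_le]) with e | e | e
    · exact k e
    · exact false_of_two_add_two hG hf hrc e h1 h4 h2 h3.symm (by grind [lt_or_eq_of_le])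
    · exact false_of_two_add_two hG hf hrc e h3 h2.symm h4.symm h1.symm (by grind [lt_or_eq_of_le])

/-- Here the path on the side of `r` is arbitrary. Its edge `s t` entering the set below `c` reduces
to the local case for `t` or for `r`, or else gives the 2+2 `r < s`, `t < c₁`. -/
theorem false_of_lt_of_adj (hG : IsIncomparabilityGraph G) (hf : IsDirectionColouring G f)
    {r c r₁ c₁ : V} (hrc : r < c) (hr : (monochromaticGraph G f).Reachable r₁ r)
    (h2 : G.Adj c c₁) (h3 : G.Adj r c₁) (h4 : G.Adj r₁ c) (hc : f c = f c₁) (h : f r ≠ f c) :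
    False := by
  have a2 := (hG _ _).1 h2
  have a3 := (hG _ _).1 h3
  have a4 := (hG _ _).1 h4
  obtain ⟨s, t, hs, hst, h5, h6⟩ := hr.exists_boundary (fun z => ¬ z < c) (by grind [lt_or_eq_of_le])
    (by simpa)
  simp only [not_not] at h5 h6
  have ast := (hG _ _).1 hst.1
  have hfr := eq_of_reachable hr
  have hfs := eq_of_reachable hs
  have hft := hst.2
  have k1 : G.Adj s c := (hG _ _).2 (by grind [lt_or_eq_of_le])
  by_cases k2 : G.Adj t c₁
  · exact false_of_local hG hf h6 hst.1.symm h2 k2 k1 hft.symm hc (by grind [lt_or_eq_of_le])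
  rw [hG] at k2
  have htc : t < c₁ := by grind [lt_or_eq_of_le]
  by_cases k3 : G.Adj r s
  · exact false_of_local hG hf hrc k3 h2 h3 k1 (by grind [lt_or_eq_of_le]) hc h
  rw [hG] at k3
  have hrs : r < s := by grind [lt_or_eq_of_le]
  exact false_of_two_add_two hG hf hrs htc ((hG _ _).2 (by grind [lt_or_eq_of_le])) hst.1.symm
    ((hG _ _).2 (by grind [lt_or_eq_of_le])) h3.symm (by grind [lt_or_eq_of_le])

/-- Now both paths are arbitrary. The edge `s t` on the side of `c` enters the set above `r`. If the
whole component of `r` is below `t`, the previous lemma applies to `c` and `s`, or `s < c`, `r₁ < t`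
is a 2+2. Otherwise that component has a vertex incomparable to `t`, and the previous lemma applies
to `r < t`. -/
theorem false_of_lt_of_touch (hG : IsIncomparabilityGraph G) (hf : IsDirectionColouring G f)
    {r c r₁ c₁ : V} (hrc : r < c) (hr : (monochromaticGraph G f).Reachable r₁ r)
    (hc : (monochromaticGraph G f).Reachable c₁ c) (h3 : G.Adj r c₁) (h4 : G.Adj r₁ c)
    (h : f r ≠ f c) : False := by
  have a3 := (hG _ _).1 h3
  have a4 := (hG _ _).1 h4
  obtain ⟨s, t, hs, hst, h5, h6⟩ := hc.exists_boundary (fun z => ¬ r < z) (by grind [lt_or_eq_of_le])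
    (by simpa)
  simp only [not_not] at h5 h6
  have ast := (hG _ _).1 hst.1
  have hfr := eq_of_reachable hr
  have hfc := eq_of_reachable hc
  have hfs := eq_of_reachable hs
  have hft := hst.2
  have k1 : G.Adj r s := (hG _ _).2 (by grind [lt_or_eq_of_le])
  by_cases k2 : ∀ z, (monochromaticGraph G f).Reachable z r → z < t
  · by_cases k3 : G.Adj s c
    · exact false_of_lt_of_adj hG hf hrc hr k3.symm k1 h4 (by grind [lt_or_eq_of_le]) h
    rw [hG] at k3
    have k4 := k2 _ hr
    have hsc : s < c := by grind [lt_or_eq_of_le]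
    exact false_of_two_add_two hG hf hsc k4 ((hG _ _).2 (by grind [lt_or_eq_of_le])) h4
      ((hG _ _).2 (by grind [lt_or_eq_of_le]))
      hst.1.symm (by grind [lt_or_eq_of_le])
  · push Not at k2
    obtain ⟨z, hz, hzt⟩ := k2
    obtain ⟨u, v, hu, huv, h7, h8⟩ := hz.exists_boundary (fun z => ¬ z < t) hzt (by simpa)
    simp only [not_not] at h7 h8
    have auv := (hG _ _).1 huv.1
    have hfu := eq_of_reachable hu
    have hfz := eq_of_reachable hz
    exact false_of_lt_of_adj hG hf h6 (hu.symm.trans hz) hst.1.symm k1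
      ((hG _ _).2 (by grind [lt_or_eq_of_le]))
      (by grind [lt_or_eq_of_le]) (by grind [lt_or_eq_of_le])

/-- If `r` has a neighbour in the component of `c` and `c` has a neighbour in the component of
`r`, then `r` and `c` are adjacent. -/
theorem adj_of_touch (hG : IsIncomparabilityGraph G) (hf : IsDirectionColouring G f)
    {r c r₁ c₁ : V} (hr : (monochromaticGraph G f).Reachable r₁ r)
    (hc : (monochromaticGraph G f).Reachable c₁ c) (h3 : G.Adj r c₁) (h4 : G.Adj r₁ c)
    (h : f r ≠ f c) : G.Adj r c := by
  rcases adj_or_lt hG (x := r) (y := c) (by grind [lt_or_eq_of_le]) with e | e | e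
  · exact e
  · exact (false_of_lt_of_touch hG hf e hr hc h3 h4 h).elim
  · exact (false_of_lt_of_touch hG hf e hc hr h4.symm h3.symm h.symm).elim

/-- A vertex without a neighbour in a component lies entirely below or above it. -/
theorem touch_trichotomy (hG : IsIncomparabilityGraph G) {r c : V} (h : f r ≠ f c) :
    (∃ c', (monochromaticGraph G f).Reachable c c' ∧ G.Adj r c') ∨
      (∀ c', (monochromaticGraph G f).Reachable c c' → r < c') ∨
      (∀ c', (monochromaticGraph G f).Reachable c c' → c' < r) := by
  by_contra! H
  obtain ⟨H1, ⟨x, hx, hx'⟩, ⟨y, hy, hy'⟩⟩ := H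
  have key : ∀ z, (monochromaticGraph G f).Reachable c z → r < z ∨ z < r := fun z hz => by
    have := eq_of_reachable hz
    rcases adj_or_lt hG (x := r) (y := z) (by grind [lt_or_eq_of_le]) with e | e | e
    · exact (H1 z hz e).elim
    · exact Or.inl e
    · exact Or.inr e
  obtain ⟨s, t, hs, hst, h1, h2⟩ := (hx.symm.trans hy).exists_boundary (fun z => ¬ r < z) hx'
    (by have := key y hy; grind)
  have k1 := key s (hx.trans hs)
  have k2 := key t ((hx.trans hs).trans hst.reachable)
  have ast := (hG _ _).1 hst.1
  grind

/-- No edges join distinct components of one colour, so being above `u` propagates along the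
component of `v`. With the mirror statement below, this orders the parallel lines linearly. -/
theorem lt_of_reachable_right (hG : IsIncomparabilityGraph G) {u v w : V} (hf : f u = f v)
    (h : ¬ (monochromaticGraph G f).Reachable u v) (huv : u < v)
    (hw : (monochromaticGraph G f).Reachable v w) : u < w := by
  by_contra hn
  obtain ⟨s, t, hs, hst, h1, h2⟩ := hw.exists_boundary (fun z => u < z) huv hn
  have ast := (hG _ _).1 hst.1
  have e1 := eq_of_reachable hs
  have e2 := hst.2
  have hvt := hs.trans hst.reachable
  have hut : u ≠ t := fun e => h (e ▸ hvt.symm)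
  refine h (SimpleGraph.Reachable.trans (SimpleGraph.Adj.reachable (v := t) ⟨?_, by grind⟩)
    hvt.symm)
  exact (hG _ _).2 (by grind [lt_or_eq_of_le])

theorem lt_of_reachable_left (hG : IsIncomparabilityGraph G) {u v w : V} (hf : f u = f v)
    (h : ¬ (monochromaticGraph G f).Reachable u v) (huv : u < v)
    (hw : (monochromaticGraph G f).Reachable u w) : w < v := by
  by_contra hn
  obtain ⟨s, t, hs, hst, h1, h2⟩ := hw.exists_boundary (fun z => z < v) huv hn
  have ast := (hG _ _).1 hst.1
  have e1 := eq_of_reachable hs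
  have e2 := hst.2
  have hut := hs.trans hst.reachable
  have hvt : v ≠ t := fun e => h (e ▸ hut)
  refine h (hut.trans (SimpleGraph.Adj.reachable (v := v) ⟨?_, by grind⟩))
  exact (hG _ _).2 (by grind [lt_or_eq_of_le])

end IsDirectionColouring

/-! ### Coordinates of the segments -/

theorem Set.Finite.exists_separating {A B : Set ℤ} (hA : A.Finite) (hne : A.Nonempty)
    (h : ∀ a ∈ A, ∀ b ∈ B, a < b) : ∃ c, (∀ a ∈ A, a ≤ c) ∧ ∀ b ∈ B, c < b := by
  obtain ⟨m, hm, hmax⟩ := hA.exists_maximal hne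
  exact ⟨m, fun a ha => (le_total a m).elim id (hmax ha), fun b hb => h m hm b hb⟩

namespace IsDirectionColouring

variable {V : Type*} [PartialOrder V]

/-- The coordinate of the line of the vertex `v`. -/
noncomputable def linePosition (G : SimpleGraph V) (f : V → Bool) (v : V) : ℤ :=
  -- Lines sit at positive multiples of `Nat.card V + 2`. A segment start is such a multiple plus `1
  -- + j` with `0 ≤ j ≤ Nat.card V`, hence strictly between two consecutive multiples.
  (Nat.card V + 2 : ℤ) *
    (1 + {u | f u = f v ∧ ¬ (monochromaticGraph G f).Reachable v u ∧ u < v}.ncard)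

/-- The smaller end of the segment of the vertex `v` on its line. -/
noncomputable def segmentStart (G : SimpleGraph V) (f : V → Bool) (v : V) : ℤ :=
  (Nat.card V + 2 : ℤ) *
    {u | f u ≠ f v ∧ ∀ w, (monochromaticGraph G f).Reachable u w → w < v}.ncard + 1 +
    {u | (monochromaticGraph G f).Reachable v u ∧ u < v}.ncard

variable {G : SimpleGraph V} {f : V → Bool}

theorem below_line_iff (hG : IsIncomparabilityGraph G) {c c' : V}
    (h : (monochromaticGraph G f).Reachable c c') (u : V) :
    (f u = f c ∧ ¬ (monochromaticGraph G f).Reachable c u ∧ u < c) ↔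
      (f u = f c' ∧ ¬ (monochromaticGraph G f).Reachable c' u ∧ u < c') := by
  have key : ∀ c c', (monochromaticGraph G f).Reachable c c' →
      (f u = f c ∧ ¬ (monochromaticGraph G f).Reachable c u ∧ u < c) →
      (f u = f c' ∧ ¬ (monochromaticGraph G f).Reachable c' u ∧ u < c') := by
    rintro c c' h ⟨h1, h2, h3⟩
    exact ⟨h1.trans (eq_of_reachable h), fun e => h2 (h.trans e),
      lt_of_reachable_right hG h1 (fun e => h2 e.symm) h3 h⟩
  exact ⟨key c c' h, key c' c h.symm⟩

theorem linePosition_eq (hG : IsIncomparabilityGraph G) {c c' : V}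
    (h : (monochromaticGraph G f).Reachable c c') :
    linePosition G f c = linePosition G f c' := by
  simp only [linePosition, below_line_iff hG h]

/-- A line which is not above `r` is below every vertex above `r` on the line of `r`. -/
theorem below_of_not_above (hG : IsIncomparabilityGraph G) (hf : IsDirectionColouring G f)
    {r r' c : V} (hr : (monochromaticGraph G f).Reachable r r') (hlt : r < r') (hc : f c ≠ f r)
    (h : ¬ ∀ w, (monochromaticGraph G f).Reachable c w → r < w) :
    ∀ w, (monochromaticGraph G f).Reachable c w → w < r' := by
  have hfr := eq_of_reachable hr
  rcases touch_trichotomy (f := f) hG (r := r') (c := c) (by grind) with ⟨c', h1, h2⟩ | h1 | h1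
  · rcases touch_trichotomy (f := f) hG (r := r) (c := c) hc.symm with ⟨d, h3, h4⟩ | h3 | h3
    · have hfc := eq_of_reachable h1
      -- If both `r` and `r'` touch the line of `c`, the neighbour `c'` of `r'` is adjacent to `r`
      -- as well, although its neighbours on their line form a clique.
      have h5 : G.Adj r c' := by
        have hdc := h3.symm.trans h1
        have h6 : f r ≠ f c' := by grind
        exact adj_of_touch hG hf hr.symm hdc h4 h2 h6
      exact (false_of_adj_of_lt hG hf hr hlt h5 h2.symm (by grind)).elim
    · exact absurd h3 h
    · exact fun w hw => (h3 w hw).trans hlt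
  · exact (h fun w hw => hlt.trans (h1 w hw)).elim
  · exact h1

variable [Finite V]

theorem linePosition_lt (hG : IsIncomparabilityGraph G) {c c' : V} (hf : f c = f c')
    (h : ¬ (monochromaticGraph G f).Reachable c c') (hlt : c < c') :
    linePosition G f c < linePosition G f c' := by
  have : {u | f u = f c ∧ ¬ (monochromaticGraph G f).Reachable c u ∧ u < c}.ncard <
      {u | f u = f c' ∧ ¬ (monochromaticGraph G f).Reachable c' u ∧ u < c'}.ncard := by
    apply Set.ncard_lt_ncard _ (Set.toFinite _)
    refine ⟨fun u hu => ⟨hu.1.trans hf, fun e => ?_, hu.2.2.trans hlt⟩, fun hs => ?_⟩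
    · exact lt_asymm hu.2.2 (lt_of_reachable_right hG hf h hlt e)
    · exact lt_irrefl _ (hs ⟨hf, fun e => h e.symm, hlt⟩ : _ ∧ _ ∧ c < c).2.2
  unfold linePosition
  gcongr

theorem linePosition_ne (hG : IsIncomparabilityGraph G) {c c' : V} (hf : f c = f c')
    (h : ¬ (monochromaticGraph G f).Reachable c c') :
    linePosition G f c ≠ linePosition G f c' := by
  have hne : c ≠ c' := fun e => h (e ▸ SimpleGraph.Reachable.refl _)
  rcases adj_or_lt hG hne with e | e | e
  · exact (h (SimpleGraph.Adj.reachable (G := monochromaticGraph G f) ⟨e, hf⟩)).elim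
  · exact (linePosition_lt hG hf h e).ne
  · exact (linePosition_lt hG hf.symm (fun e => h e.symm) e).ne'

/-- Everything counted for the line of `c` is counted for the start of `r`, and `c` itself is
counted in addition; this strictness absorbs the `1 +` in `linePosition`. -/
theorem linePosition_lt_segmentStart (hG : IsIncomparabilityGraph G) {r c : V} (hf : f c ≠ f r)
    (h : ∀ w, (monochromaticGraph G f).Reachable c w → w < r) :
    linePosition G f c < segmentStart G f r := by
  have h1 : {u | f u = f c ∧ ¬ (monochromaticGraph G f).Reachable c u ∧ u < c}.ncard <
      {u | f u ≠ f r ∧ ∀ w, (monochromaticGraph G f).Reachable u w → w < r}.ncard := by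
    apply Set.ncard_lt_ncard _ (Set.toFinite _)
    refine ⟨fun u hu => ⟨fun e => hf (hu.1.symm.trans e), fun w hw => ?_⟩, fun hs => ?_⟩
    · exact (lt_of_reachable_left hG hu.1 (fun e => hu.2.1 e.symm) hu.2.2 hw).trans
        (h c (SimpleGraph.Reachable.refl _))
    · exact lt_irrefl _ (hs ⟨hf, h⟩ : _ ∧ _ ∧ c < c).2.2
  unfold linePosition segmentStart
  have h2 : (1 + {u | f u = f c ∧ ¬ (monochromaticGraph G f).Reachable c u ∧ u < c}.ncard : ℤ) ≤
      {u | f u ≠ f r ∧ ∀ w, (monochromaticGraph G f).Reachable u w → w < r}.ncard := by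
    omega
  have h3 := mul_le_mul_of_nonneg_left h2 (by positivity : (0 : ℤ) ≤ Nat.card V + 2)
  linarith [Int.natCast_nonneg {u | (monochromaticGraph G f).Reachable r u ∧ u < r}.ncard]

theorem segmentStart_lt_linePosition (hG : IsIncomparabilityGraph G) {r c : V} (hf : f c ≠ f r)
    (h : ¬ ∀ w, (monochromaticGraph G f).Reachable c w → w < r) :
    segmentStart G f r < linePosition G f c := by
  have h1 : {u | f u ≠ f r ∧ ∀ w, (monochromaticGraph G f).Reachable u w → w < r}.ncard ≤
      {u | f u = f c ∧ ¬ (monochromaticGraph G f).Reachable c u ∧ u < c}.ncard := by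
    apply Set.ncard_le_ncard _ (Set.toFinite _)
    rintro u ⟨hu1, hu2⟩
    have hfu : f u = f c := (Bool.eq_not.2 hu1).trans (Bool.eq_not.2 hf).symm
    have hn : ¬ (monochromaticGraph G f).Reachable c u :=
      fun e => h fun w hw => hu2 w (e.symm.trans hw)
    refine ⟨hfu, hn, ?_⟩
    have hne : u ≠ c := fun e => hn (e ▸ SimpleGraph.Reachable.refl _)
    rcases adj_or_lt hG hne with e | e | e
    · exact (hn (SimpleGraph.Adj.reachable (G := monochromaticGraph G f)
        ⟨e.symm, hfu.symm⟩)).elim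
    · exact e
    · exact (h fun w hw => (lt_of_reachable_left hG hfu.symm hn e hw).trans
        (hu2 u (SimpleGraph.Reachable.refl _))).elim
  have h2 : {u | (monochromaticGraph G f).Reachable r u ∧ u < r}.ncard ≤ Nat.card V := by
    rw [← Set.ncard_univ]
    exact Set.ncard_le_ncard (Set.subset_univ _) (Set.toFinite _)
  unfold linePosition segmentStart
  have h3 : ({u | f u ≠ f r ∧ ∀ w, (monochromaticGraph G f).Reachable u w → w < r}.ncard : ℤ) ≤
      {u | f u = f c ∧ ¬ (monochromaticGraph G f).Reachable c u ∧ u < c}.ncard := by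
    omega
  have h4 := mul_le_mul_of_nonneg_left h3 (by positivity : (0 : ℤ) ≤ Nat.card V + 2)
  have h5 : ({u | (monochromaticGraph G f).Reachable r u ∧ u < r}.ncard : ℤ) ≤ Nat.card V := by
    omega
  linarith

/-- On one line, starts that the segment of `r` must reach precede those it must miss. The main
terms are comparable by `below_of_not_above`. For the correction terms, `u < r'` with `u` not below
`r''` would make `u < r'`, `r < r''` a monochromatic 2+2; strictness comes from `r` itself. -/
theorem segmentStart_lt_segmentStart (hG : IsIncomparabilityGraph G)
    (hf : IsDirectionColouring G f) {r r' r'' : V}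
    (h' : (monochromaticGraph G f).Reachable r r') (h'' : (monochromaticGraph G f).Reachable r r'')
    (hr' : ¬ r < r') (hr'' : r < r'') : segmentStart G f r' < segmentStart G f r'' := by
  have hf' := eq_of_reachable h'
  have hf'' := eq_of_reachable h''
  have h1 : {u | f u ≠ f r' ∧ ∀ w, (monochromaticGraph G f).Reachable u w → w < r'}.ncard ≤
      {u | f u ≠ f r'' ∧ ∀ w, (monochromaticGraph G f).Reachable u w → w < r''}.ncard := by
    apply Set.ncard_le_ncard _ (Set.toFinite _)
    rintro u ⟨hu1, hu2⟩
    refine ⟨by grind, below_of_not_above hG hf h'' hr'' (by grind) fun e => ?_⟩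
    have := e u (SimpleGraph.Reachable.refl _)
    exact hr' (this.trans (hu2 u (SimpleGraph.Reachable.refl _)))
  have h2 : {u | (monochromaticGraph G f).Reachable r' u ∧ u < r'}.ncard <
      {u | (monochromaticGraph G f).Reachable r'' u ∧ u < r''}.ncard := by
    apply Set.ncard_lt_ncard _ (Set.toFinite _)
    refine ⟨?_, fun hs => ?_⟩
    · rintro u ⟨hu1, hu2⟩
      refine ⟨(h''.symm.trans h').trans hu1, ?_⟩
      by_contra hn
      have hfu := eq_of_reachable hu1
      exact false_of_two_add_two hG hf hu2 hr'' ((hG _ _).2 (by grind [lt_or_eq_of_le]))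
        ((hG _ _).2 (by grind [lt_or_eq_of_le])) ((hG _ _).2 (by grind [lt_or_eq_of_le]))
        ((hG _ _).2 (by grind [lt_or_eq_of_le])) (by grind)
    · exact hr' (hs (⟨h''.symm, hr''⟩ : _ ∧ r < r'')).2
  unfold segmentStart
  have h3 := mul_le_mul_of_nonneg_left (Int.ofNat_le.2 h1)
    (by positivity : (0 : ℤ) ≤ Nat.card V + 2)
  have h4 := Int.ofNat_lt.2 h2
  linarith

/-- The segment of `r` has to reach just the starts on its line and the crossing lines that are not
above `r`. Each of these coordinates is smaller than each one to be missed, so a separating integer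
exists. -/
theorem exists_segmentEnd (hG : IsIncomparabilityGraph G) (hf : IsDirectionColouring G f) (r : V) :
    ∃ e : ℤ, (∀ r', (monochromaticGraph G f).Reachable r r' →
        (segmentStart G f r' ≤ e ↔ ¬ r < r')) ∧
      ∀ c, f c ≠ f r → (linePosition G f c ≤ e ↔
        ¬ ∀ w, (monochromaticGraph G f).Reachable c w → r < w) := by
  obtain ⟨e, h1, h2⟩ := Set.Finite.exists_separating
    (A := segmentStart G f '' {r' | (monochromaticGraph G f).Reachable r r' ∧ ¬ r < r'} ∪
      linePosition G f '' {c | f c ≠ f r ∧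
        ¬ ∀ w, (monochromaticGraph G f).Reachable c w → r < w})
    (B := segmentStart G f '' {r' | (monochromaticGraph G f).Reachable r r' ∧ r < r'} ∪
      linePosition G f '' {c | f c ≠ f r ∧
        ∀ w, (monochromaticGraph G f).Reachable c w → r < w})
    (((Set.toFinite _).image _).union ((Set.toFinite _).image _))
    ⟨_, Or.inl ⟨r, ⟨SimpleGraph.Reachable.refl _, lt_irrefl r⟩, rfl⟩⟩ (by
      rintro _ (⟨r', ⟨hr1, hr2⟩, rfl⟩ | ⟨c, ⟨hc1, hc2⟩, rfl⟩) _
        (⟨s, ⟨hs1, hs2⟩, rfl⟩ | ⟨d, ⟨hd1, hd2⟩, rfl⟩)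
      · exact segmentStart_lt_segmentStart hG hf hr1 hs1 hr2 hs2
      · have := eq_of_reachable hr1
        exact segmentStart_lt_linePosition hG (by grind) fun e =>
          hr2 ((hd2 d (SimpleGraph.Reachable.refl _)).trans (e d (SimpleGraph.Reachable.refl _)))
      · have := eq_of_reachable hs1
        exact linePosition_lt_segmentStart hG (by grind)
          (below_of_not_above hG hf hs1 hs2 hc1 hc2)
      · have hcd : f c = f d := (Bool.eq_not.2 hc1).trans (Bool.eq_not.2 hd1).symm
        have hn : ¬ (monochromaticGraph G f).Reachable c d :=
          fun e => hc2 fun w hw => hd2 w (e.symm.trans hw)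
        refine linePosition_lt hG hcd hn ?_
        have hne : c ≠ d := fun e => hn (e ▸ SimpleGraph.Reachable.refl _)
        rcases adj_or_lt hG hne with e | e | e
        · exact (hn (SimpleGraph.Adj.reachable (G := monochromaticGraph G f) ⟨e, hcd⟩)).elim
        · exact e
        · exact (hc2 fun w hw => (hd2 d (SimpleGraph.Reachable.refl _)).trans
            (lt_of_reachable_right hG hcd.symm (fun e => hn e.symm) e hw)).elim)
  refine ⟨e, fun r' hr => ⟨fun h h' => ?_, fun h => ?_⟩, fun c hc => ⟨fun h h' => ?_, fun h => ?_⟩⟩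
  · exact absurd (h2 _ (Or.inl ⟨r', ⟨hr, h'⟩, rfl⟩)) h.not_gt
  · exact h1 _ (Or.inl ⟨r', ⟨hr, h⟩, rfl⟩)
  · exact absurd (h2 _ (Or.inr ⟨c, ⟨hc, h'⟩, rfl⟩)) h.not_gt
  · exact h1 _ (Or.inr ⟨c, ⟨hc, h⟩, rfl⟩)

/-- An incomparability graph with a direction colouring is an intersection graph of segments. -/
theorem hasSegmentRep (hG : IsIncomparabilityGraph G) (hf : IsDirectionColouring G f) :
    HasSegmentRep G := by
  choose e he1 he2 using fun r => exists_segmentEnd (f := f) hG hf r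
  have hstart : ∀ r c, f c ≠ f r → (segmentStart G f r ≤ linePosition G f c ↔
      ¬ ∀ w, (monochromaticGraph G f).Reachable c w → w < r) := fun r c hrc =>
    ⟨fun h h' => absurd (linePosition_lt_segmentStart hG hrc h') h.not_gt,
      fun h => (segmentStart_lt_linePosition hG hrc h).le⟩
  have hse : ∀ v, segmentStart G f v ≤ e v := fun v =>
    (he1 v v (SimpleGraph.Reachable.refl _)).2 (lt_irrefl v)
  -- The segment of `r` spans the coordinate of a crossing line exactly when `r` has a neighbour on
  -- that line.
  have hmem : ∀ r c, f c ≠ f r →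
      ((segmentStart G f r ≤ linePosition G f c ∧ linePosition G f c ≤ e r) ↔
        ∃ c', (monochromaticGraph G f).Reachable c c' ∧ G.Adj r c') := by
    intro r c hrc
    rw [hstart r c hrc, he2 r c hrc]
    constructor
    · rintro ⟨h1, h2⟩
      rcases touch_trichotomy (f := f) hG (r := r) (c := c) hrc.symm with h | h | h
      exacts [h, absurd h h2, absurd h h1]
    · rintro ⟨c', h1, h2⟩
      have := (hG _ _).1 h2
      exact ⟨fun h => this.2 (h c' h1).le, fun h => this.1 (h c' h1).le⟩
  have hcross : ∀ r c, f c ≠ f r → (G.Adj r c ↔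
      (segmentStart G f r ≤ linePosition G f c ∧ linePosition G f c ≤ e r) ∧
      (segmentStart G f c ≤ linePosition G f r ∧ linePosition G f r ≤ e c)) := by
    intro r c hrc
    rw [hmem r c hrc, hmem c r hrc.symm]
    constructor
    · exact fun h => ⟨⟨c, SimpleGraph.Reachable.refl _, h⟩,
        ⟨r, SimpleGraph.Reachable.refl _, h.symm⟩⟩
    · rintro ⟨⟨c', h1, h2⟩, ⟨r', h3, h4⟩⟩
      exact adj_of_touch hG hf h3.symm h1.symm h2 h4.symm hrc.symm
  have hsame : ∀ u v, u ≠ v → f u = f v → (G.Adj u v ↔ linePosition G f u = linePosition G f v ∧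
      segmentStart G f u ≤ e v ∧ segmentStart G f v ≤ e u) := by
    intro u v huv hfuv
    by_cases h : (monochromaticGraph G f).Reachable u v
    · rw [he1 u v h, he1 v u h.symm, hG]
      simp only [linePosition_eq hG h, true_and]
      grind [lt_or_eq_of_le]
    · refine iff_of_false (fun e => h ?_) (fun e => linePosition_ne hG hfuv h e.1)
      exact SimpleGraph.Adj.reachable (G := monochromaticGraph G f) ⟨e, hfuv⟩
  -- The colour `true` is drawn horizontally, `false` vertically.
  refine ⟨fun v => if f v then segmentStart G f v else linePosition G f v,
    fun v => if f v then e v else linePosition G f v,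
    fun v => if f v then linePosition G f v else segmentStart G f v,
    fun v => if f v then linePosition G f v else e v, fun v => ?_, fun u v huv => ?_⟩
  · have := hse v
    by_cases hv : f v <;> simp [hv, this]
  · have h1 := hcross u v
    have h2 := hsame u v huv
    cases hu : f u <;> cases hv : f v <;> simp only [hu, hv, if_true, if_false, Bool.false_eq_true,
      ne_eq, not_false_eq_true, forall_const, not_true_eq_false, reduceCtorEq]
      at h1 h2 ⊢
    · rw [h2]; omega
    · rw [h1]; omega
    · rw [h1]; omega
    · rw [h2]; omega

end IsDirectionColouring

/-! ### Constrained edges in a comparability graph -/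

/-- `G` is the comparability graph of the partial order on its vertices. -/
def IsOrderComparabilityGraph {V : Type*} [PartialOrder V] (G : SimpleGraph V) : Prop :=
  ∀ x y, G.Adj x y ↔ x < y ∨ y < x

/-- No two vertices of an induced four-cycle are diamond related. -/
def SquaresUnrelated {V : Type*} (G : SimpleGraph V) : Prop :=
  ∀ x y z w, InducesSquare G x y z w → ¬ DiamondRelated G x y ∧ ¬ DiamondRelated G x z

/-- The edge `x y` lies on an induced four-cycle. -/
def IsSquareEdge {V : Type*} (G : SimpleGraph V) (x y : V) : Prop :=
  ∃ z w, InducesSquare G x y z w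

section Edges

variable {V : Type*} {G : SimpleGraph V} {x y z w : V}

theorem IsSquareEdge.symm (h : IsSquareEdge G x y) : IsSquareEdge G y x := by
  obtain ⟨z, w, h⟩ := h
  exact ⟨_, _, h.reverse⟩

theorem IsDiamondDiagonal.symm (h : IsDiamondDiagonal G x y) : IsDiamondDiagonal G y x :=
  (diamondDiagonalGraph G).symm.symm _ _ h

theorem IsDiamondDiagonal.diamondRelated (h : IsDiamondDiagonal G x y) : DiamondRelated G x y :=
  SimpleGraph.Adj.reachable (G := diamondDiagonalGraph G) h

/-- The edge `x y` is an edge of an induced four-cycle or a diamond diagonal. -/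
def IsConstrained (G : SimpleGraph V) (x y : V) : Prop :=
  IsSquareEdge G x y ∨ IsDiamondDiagonal G x y

theorem IsConstrained.symm (h : IsConstrained G x y) : IsConstrained G y x :=
  h.imp IsSquareEdge.symm IsDiamondDiagonal.symm

theorem IsConstrained.adj (h : IsConstrained G x y) : G.Adj x y := by
  rcases h with ⟨z, w, h⟩ | h
  exacts [h.adj₁, h.1]

theorem IsSquareEdge.not_isDiamondDiagonal (H : SquaresUnrelated G) (h : IsSquareEdge G x y) :
    ¬ IsDiamondDiagonal G x y := by
  obtain ⟨z, w, h⟩ := h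
  exact fun e => (H _ _ _ _ h).1 e.diamondRelated

variable [PartialOrder V]

/-- In the square `x, y, w, b` the vertices `x`, `w` are minimal and `y`, `b` maximal. Either `z`
can replace `y`, or `z` is above `b` too; then `x z` and `w z` are diamond diagonals over `y`, `b`,
making the opposite vertices `x`, `w` diamond related. -/
theorem IsSquareEdge.trans_lt (hG : IsOrderComparabilityGraph G) (H : SquaresUnrelated G)
    (h : IsSquareEdge G x y) (hxy : x < y) (hyz : y < z) : IsSquareEdge G x z := by
  obtain ⟨w, b, h⟩ := h
  have hs := H _ _ _ _ h
  obtain ⟨h1, h2, h3, h4, n1, n2, h5, h6⟩ := h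
  rw [hG] at h1 h2 h3 h4 h5 h6
  have hwy : w < y := by grind
  have hxb : x < b := by grind
  have hwb : w < b := by grind
  have hxz := hxy.trans hyz
  have hwz := hwy.trans hyz
  by_cases k : G.Adj z b
  · rw [hG] at k
    have hbz : b < z := by grind
    exfalso
    have e1 : IsDiamondDiagonal G x z := ⟨(hG _ _).2 (Or.inl hxz), y, b, n2, by rwa [hG],
      (hG _ _).2 (Or.inl hxy), (hG _ _).2 (Or.inl hyz), (hG _ _).2 (Or.inr hbz),
      (hG _ _).2 (Or.inr hxb)⟩
    have e2 : IsDiamondDiagonal G w z := ⟨(hG _ _).2 (Or.inl hwz), y, b, n2, by rwa [hG],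
      (hG _ _).2 (Or.inl hwy), (hG _ _).2 (Or.inl hyz), (hG _ _).2 (Or.inr hbz),
      (hG _ _).2 (Or.inr hwb)⟩
    exact hs.2 (e1.diamondRelated.trans e2.diamondRelated.symm)
  · refine ⟨w, b, (hG _ _).2 (Or.inl hxz), (hG _ _).2 (Or.inr hwz), (hG _ _).2 (Or.inl hwb),
      (hG _ _).2 (Or.inr hxb), n1, fun e => ?_, by rwa [hG], k⟩
    rw [hG] at k
    grind

theorem IsOrderComparabilityGraph.dual (hG : IsOrderComparabilityGraph G) :
    @IsOrderComparabilityGraph V (OrderDual.instPartialOrder V) G :=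
  fun x y => (hG x y).trans or_comm

theorem IsSquareEdge.lt_trans (hG : IsOrderComparabilityGraph G) (H : SquaresUnrelated G)
    (h : IsSquareEdge G x y) (hxy : x < y) (hzx : z < x) : IsSquareEdge G z y :=
  (@IsSquareEdge.trans_lt V G y x z (OrderDual.instPartialOrder V) hG.dual H h.symm hxy hzx).symm

theorem isDiamondDiagonal_of_below (hG : IsOrderComparabilityGraph G) (hxy : x < y) (hzw : z ≠ w)
    (hn : ¬ G.Adj z w) (hz : y < z) (hw : y < w) : IsDiamondDiagonal G x y :=
  ⟨(hG _ _).2 (Or.inl hxy), z, w, hzw, hn, (hG _ _).2 (Or.inl (hxy.trans hz)),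
    (hG _ _).2 (Or.inr hz), (hG _ _).2 (Or.inl hw), (hG _ _).2 (Or.inr (hxy.trans hw))⟩

theorem isDiamondDiagonal_of_above (hG : IsOrderComparabilityGraph G) (hxy : x < y) (hzw : z ≠ w)
    (hn : ¬ G.Adj z w) (hz : z < x) (hw : w < x) : IsDiamondDiagonal G x y :=
  ⟨(hG _ _).2 (Or.inl hxy), z, w, hzw, hn, (hG _ _).2 (Or.inr hz),
    (hG _ _).2 (Or.inl (hz.trans hxy)), (hG _ _).2 (Or.inr (hw.trans hxy)),
    (hG _ _).2 (Or.inl hw)⟩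

theorem isDiamondDiagonal_of_between (hG : IsOrderComparabilityGraph G) (hzw : z ≠ w)
    (hn : ¬ G.Adj z w) (hxz : x < z) (hxw : x < w) (hzy : z < y) (hwy : w < y) :
    IsDiamondDiagonal G x y :=
  ⟨(hG _ _).2 (Or.inl (hxz.trans hzy)), z, w, hzw, hn, (hG _ _).2 (Or.inl hxz),
    (hG _ _).2 (Or.inl hzy), (hG _ _).2 (Or.inr hwy), (hG _ _).2 (Or.inr hxw)⟩

theorem IsDiamondDiagonal.position (hG : IsOrderComparabilityGraph G)
    (h : IsDiamondDiagonal G x y) (hxy : x < y) :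
    ∃ a b, a ≠ b ∧ ¬ G.Adj a b ∧
      ((y < a ∧ y < b) ∨ (a < x ∧ b < x) ∨ (x < a ∧ x < b ∧ a < y ∧ b < y)) := by
  obtain ⟨_, a, b, hab, hn, h1, h2, h3, h4⟩ := h
  refine ⟨a, b, hab, hn, ?_⟩
  rw [hG] at *
  grind

/-- In a chain `u < x < y < v` with `x y` constrained, one of `u y` and `x v` is constrained. -/
theorem IsConstrained.extend (hG : IsOrderComparabilityGraph G) (H : SquaresUnrelated G)
    {u v : V} (h : IsConstrained G x y) (hxy : x < y) (hu : u < x) (hv : y < v) :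
    IsConstrained G u y ∨ IsConstrained G x v := by
  rcases h with h | h
  · exact Or.inl (Or.inl (h.lt_trans hG H hxy hu))
  · obtain ⟨a, b, hab, hn, ⟨h1, h2⟩ | ⟨h1, h2⟩ | ⟨h1, h2, h3, h4⟩⟩ := h.position hG hxy
    · exact Or.inl (Or.inr (isDiamondDiagonal_of_below hG (hu.trans hxy) hab hn h1 h2))
    · exact Or.inr (Or.inr (isDiamondDiagonal_of_above hG (hxy.trans hv) hab hn h1 h2))
    · exact Or.inr (Or.inr (isDiamondDiagonal_of_between hG hab hn h1 h2 (h3.trans hv)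
        (h4.trans hv)))

end Edges

/-! ### Closed walks of odd parity -/

open Classical in
/-- The change of colour along a constrained edge. -/
noncomputable def edgeParity {V : Type*} (G : SimpleGraph V) (x y : V) : ZMod 2 :=
  if IsSquareEdge G x y then 1 else 0

theorem IsSquareEdge.edgeParity_eq {V : Type*} {G : SimpleGraph V} {x y : V}
    (h : IsSquareEdge G x y) : edgeParity G x y = 1 := if_pos h

theorem edgeParity_eq_zero {V : Type*} {G : SimpleGraph V} {x y : V}
    (h : ¬ IsSquareEdge G x y) : edgeParity G x y = 0 := if_neg h

theorem edgeParity_comm {V : Type*} (G : SimpleGraph V) (x y : V) :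
    edgeParity G x y = edgeParity G y x := by
  by_cases h : IsSquareEdge G x y
  · simp [edgeParity, h, h.symm]
  · have h' : ¬ IsSquareEdge G y x := fun e => h e.symm
    simp [edgeParity, h, h']

/-- A walk of length `n` along constrained edges, with total change of colour `s`. -/
inductive ConstrainedWalk {V : Type*} (G : SimpleGraph V) : ℕ → ZMod 2 → V → V → Prop
  | nil (u : V) : ConstrainedWalk G 0 0 u u
  | cons {u v w : V} {n : ℕ} {s : ZMod 2} (h : IsConstrained G u v)
      (p : ConstrainedWalk G n s v w) : ConstrainedWalk G (n + 1) (edgeParity G u v + s) u w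

namespace ConstrainedWalk

variable {V : Type*} {G : SimpleGraph V}

theorem single {u v : V} (h : IsConstrained G u v) :
    ConstrainedWalk G 1 (edgeParity G u v) u v := by
  simpa using cons h (nil v)

theorem append {m n : ℕ} {s t : ZMod 2} {u v w : V} (p : ConstrainedWalk G m s u v)
    (q : ConstrainedWalk G n t v w) : ConstrainedWalk G (m + n) (s + t) u w := by
  induction p with
  | nil => simpa using q
  | cons h p ih =>
    have := cons h (ih q)
    rwa [← add_assoc, add_right_comm] at this

theorem reverse {m : ℕ} {s : ZMod 2} {u v : V} (p : ConstrainedWalk G m s u v) :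
    ConstrainedWalk G m s v u := by
  induction p with
  | nil => exact nil _
  | cons h p ih =>
    have := ih.append (single h.symm)
    rwa [edgeParity_comm, add_comm (_ : ZMod 2)] at this

theorem exists_fun {m : ℕ} {s : ZMod 2} {u v : V} (p : ConstrainedWalk G m s u v) :
    ∃ g : ℕ → V, g 0 = u ∧ g m = v ∧ (∀ i < m, IsConstrained G (g i) (g (i + 1))) ∧
      ∑ i ∈ Finset.range m, edgeParity G (g i) (g (i + 1)) = s := by
  induction p with
  | nil u => exact ⟨fun _ => u, rfl, rfl, by simp, by simp⟩
  | @cons u v w n s h p ih =>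
    obtain ⟨g, h0, hn, hg, hs⟩ := ih
    refine ⟨fun i => Nat.casesOn i u g, rfl, hn, fun i hi => ?_, ?_⟩
    · cases i with
      | zero => simpa [h0] using h
      | succ i => exact hg i (by omega)
    · rw [Finset.sum_range_succ']
      simp only [hs, h0]
      exact add_comm _ _

theorem of_fun (g : ℕ → V) (hg : ∀ i, IsConstrained G (g i) (g (i + 1))) (k m : ℕ) :
    ConstrainedWalk G m (∑ i ∈ Finset.range m, edgeParity G (g (k + i)) (g (k + i + 1)))
      (g k) (g (k + m)) := by
  induction m with
  | zero => exact nil _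
  | succ m ih =>
    rw [Finset.sum_range_succ]
    exact ih.append (single (hg _))

end ConstrainedWalk

/-- A closed walk along constrained edges with odd total change of colour, as a periodic
sequence. -/
structure IsOddClosedWalk {V : Type*} (G : SimpleGraph V) (n : ℕ) (f : ℕ → V) : Prop where
  periodic : ∀ i, f (i + n) = f i
  step : ∀ i, IsConstrained G (f i) (f (i + 1))
  odd : ∑ i ∈ Finset.range n, edgeParity G (f i) (f (i + 1)) = 1

theorem ConstrainedWalk.exists_isOddClosedWalk {V : Type*} {G : SimpleGraph V} {n : ℕ} {u : V}
    (p : ConstrainedWalk G n 1 u u) : ∃ f, IsOddClosedWalk G n f := by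
  obtain ⟨g, h0, hn, hg, hs⟩ := p.exists_fun
  have hpos : 0 < n := by
    rcases Nat.eq_zero_or_pos n with rfl | h
    · simp at hs
    · exact h
  have key : ∀ i, g ((i + 1) % n) = g (i % n + 1) := by
    intro i
    have hi := Nat.mod_lt i hpos
    rcases Nat.lt_or_ge (i % n + 1) n with h | h
    · rw [Nat.add_mod, Nat.mod_eq_of_lt (by omega : 1 < n), Nat.mod_eq_of_lt h]
    · have h1 : i % n + 1 = n := by omega
      have h2 : (i + 1) % n = 0 := by
        rw [← Nat.mod_add_mod, h1, Nat.mod_self]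
      rw [h1, h2, h0, hn]
  refine ⟨fun i => g (i % n), fun i => by simp, fun i => ?_, ?_⟩
  · rw [key]
    exact hg _ (Nat.mod_lt i hpos)
  · rw [← hs]
    refine Finset.sum_congr rfl fun i hi => ?_
    rw [key, Nat.mod_eq_of_lt (Finset.mem_range.1 hi)]

/-- Without odd closed walks the constraints can be satisfied. -/
theorem exists_isDirectionColouring_of_forall_not {V : Type*} {G : SimpleGraph V}
    (H : SquaresUnrelated G) (h : ∀ n f, ¬ IsOddClosedWalk G n f) :
    ∃ f, IsDirectionColouring G f := by
  let S : Setoid V := ⟨fun u v => ∃ n s, ConstrainedWalk G n s u v,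
    fun u => ⟨_, _, .nil u⟩, fun ⟨_, _, p⟩ => ⟨_, _, p.reverse⟩,
    fun ⟨_, _, p⟩ ⟨_, _, q⟩ => ⟨_, _, p.append q⟩⟩
  have hr : ∀ v : V, ∃ n s, ConstrainedWalk G n s (Quotient.mk S v).out v :=
    fun v => Quotient.mk_out (s := S) v
  -- `c v` is the parity of a chosen walk from the representative of the class of `v`. An edge
  -- violating the colouring would close up to an odd walk through the representative.
  choose n c hc using hr
  have key : ∀ x y, IsConstrained G x y → c x + edgeParity G x y + c y ≠ 1 := by
    intro x y hxy he
    have hq : Quotient.mk S x = Quotient.mk S y :=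
      Quotient.sound ⟨_, _, ConstrainedWalk.single hxy⟩
    have p := ((hc x).append (.single hxy)).append (hc y).reverse
    rw [← hq, he] at p
    obtain ⟨f, hf⟩ := p.exists_isOddClosedWalk
    exact h _ f hf
  have hz : ∀ a b : ZMod 2, a + 1 + b ≠ 1 → decide (a = 1) ≠ decide (b = 1) := by decide
  have hz' : ∀ a b : ZMod 2, a + 0 + b ≠ 1 → decide (a = 1) = decide (b = 1) := by decide
  refine ⟨fun v => decide (c v = 1), fun {x y z w} hs => ?_, fun {x y} hd => ?_⟩
  · have he : IsSquareEdge G x y := ⟨z, w, hs⟩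
    have := key x y (Or.inl he)
    rw [he.edgeParity_eq] at this
    exact hz _ _ this
  · have := key x y (Or.inr hd)
    rw [edgeParity_eq_zero fun e => e.not_isDiamondDiagonal H hd] at this
    exact hz' _ _ this

namespace IsOddClosedWalk

variable {V : Type*} {G : SimpleGraph V} {n : ℕ} {f : ℕ → V}

theorem shift (h : IsOddClosedWalk G n f) (k : ℕ) : IsOddClosedWalk G n fun i => f (k + i) := by
  refine ⟨fun i => by rw [← add_assoc, h.periodic], fun i => h.step _, ?_⟩
  induction k with
  | zero => simpa using h.odd
  | succ k ih =>
    have h1 := Finset.sum_range_succ (fun i => edgeParity G (f (k + i)) (f (k + (i + 1)))) n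
    have h2 := Finset.sum_range_succ' (fun i => edgeParity G (f (k + i)) (f (k + (i + 1)))) n
    rw [h1] at h2
    have h3 : edgeParity G (f (k + n)) (f (k + (n + 1))) =
        edgeParity G (f (k + 0)) (f (k + (0 + 1))) := by
      rw [h.periodic, ← add_assoc, add_right_comm k n 1, h.periodic]
      simp
    rw [h3, add_left_inj] at h2
    rw [← ih, h2]
    exact Finset.sum_congr rfl fun i _ => by congr 2 <;> omega

theorem map_mod (h : IsOddClosedWalk G n f) (i : ℕ) : f (i % n) = f i :=
  Function.Periodic.map_mod_nat (f := f) h.periodic i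

theorem pos (h : IsOddClosedWalk G n f) : 0 < n := by
  rcases Nat.eq_zero_or_pos n with rfl | hn
  · simpa using h.odd
  · exact hn

theorem split (h : IsOddClosedWalk G n f) (i : ℕ) {j : ℕ} (hj : j ≤ n) : ∃ s t, s + t = 1 ∧
    ConstrainedWalk G j s (f i) (f (i + j)) ∧
    ConstrainedWalk G (n - j) t (f (i + j)) (f i) := by
  have p := ConstrainedWalk.of_fun f h.step i j
  have q := ConstrainedWalk.of_fun f h.step (i + j) (n - j)
  rw [show i + j + (n - j) = i + n by omega, h.periodic] at q
  refine ⟨_, _, ?_, p, q⟩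
  have := (h.shift i).odd
  rw [← Nat.add_sub_of_le hj, Finset.sum_range_add] at this
  rw [← this]
  congr 1
  exact Finset.sum_congr rfl fun k _ => by congr 2 <;> omega

/-- A closed walk of minimal length has no repeated vertices. -/
theorem ne_of_minimal (h : IsOddClosedWalk G n f) (hmin : ∀ m g, IsOddClosedWalk G m g → n ≤ m)
    {i j : ℕ} (hij : i < j) (hj : j < i + n) : f i ≠ f j := by
  intro he
  obtain ⟨s, t, hst, p, q⟩ := h.split i (show j - i ≤ n by omega)
  rw [show i + (j - i) = j by omega, ← he] at p q
  have : ∀ s t : ZMod 2, s + t = 1 → s = 1 ∨ t = 1 := by decide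
  rcases this s t hst with rfl | rfl
  · obtain ⟨g, hg⟩ := p.exists_isOddClosedWalk
    have := hmin _ _ hg
    omega
  · obtain ⟨g, hg⟩ := q.exists_isOddClosedWalk
    have := hmin _ _ hg
    omega

/-- A closed walk of minimal length has no constrained chords. -/
theorem consecutive_of_minimal (h : IsOddClosedWalk G n f)
    (hmin : ∀ m g, IsOddClosedWalk G m g → n ≤ m) {i j : ℕ} (hij : i < j) (hj : j < i + n)
    (hc : IsConstrained G (f i) (f j)) : j = i + 1 ∨ j + 1 = i + n := by
  obtain ⟨s, t, hst, p, q⟩ := h.split i (show j - i ≤ n by omega)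
  rw [show i + (j - i) = j by omega] at p q
  have p' := p.append (.single hc.symm)
  have q' := q.append (.single hc)
  rw [edgeParity_comm] at p'
  have : ∀ s t e : ZMod 2, s + t = 1 → s + e = 1 ∨ t + e = 1 := by decide
  rcases this s t (edgeParity G (f i) (f j)) hst with e | e
  · rw [e] at p'
    obtain ⟨g, hg⟩ := p'.exists_isOddClosedWalk
    have := hmin _ _ hg
    omega
  · rw [e] at q'
    obtain ⟨g, hg⟩ := q'.exists_isOddClosedWalk
    have := hmin _ _ hg
    omega

theorem three_le (h : IsOddClosedWalk G n f) : 3 ≤ n := by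
  have hpos := h.pos
  by_contra hn
  obtain rfl | rfl : n = 1 ∨ n = 2 := by omega
  · have h1 := (h.step 0).adj
    rw [h.periodic 0] at h1
    exact G.irrefl h1
  · have h1 := h.odd
    have h2 := h.periodic 0
    simp only [Finset.sum_range_succ, Finset.sum_range_zero, zero_add, Nat.reduceAdd] at h1 h2
    rw [h2, edgeParity_comm G (f 1)] at h1
    have : ∀ e : ZMod 2, e + e ≠ 1 := by decide
    exact this _ h1

end IsOddClosedWalk

/-! ### Minimal odd closed walks -/

theorem Nat.exists_boundary (p : ℕ → Prop) {a b : ℕ} (hab : a ≤ b) (ha : p a) (hb : ¬ p b) :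
    ∃ k, a ≤ k ∧ k < b ∧ p k ∧ ¬ p (k + 1) := by
  by_contra! h
  refine hb ?_
  induction b, hab using Nat.le_induction with
  | base => exact ha
  | succ n hn ih =>
    by_cases hp : p n
    · exact h n hn (Nat.lt_succ_self n) hp
    · exact (hp (ih hp fun k h1 h2 => h k h1 (by omega))).elim

namespace IsOddClosedWalk

variable {V : Type*} {G : SimpleGraph V} {n : ℕ} {f : ℕ → V}

theorem consecutive_of_lt (h : IsOddClosedWalk G n f)
    (hmin : ∀ m g, IsOddClosedWalk G m g → n ≤ m) {i j : ℕ} (hi : i < n) (hj : j < n)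
    (hc : IsConstrained G (f i) (f j)) :
    j = i + 1 ∨ i = j + 1 ∨ j + 1 = i + n ∨ i + 1 = j + n := by
  rcases lt_trichotomy i j with hij | rfl | hij
  · rcases h.consecutive_of_minimal hmin hij (by omega) hc with e | e <;> omega
  · exact (G.irrefl hc.adj).elim
  · rcases h.consecutive_of_minimal hmin hij (by omega) hc.symm with e | e <;> omega

section Incomparability

variable [PartialOrder V]

/-- The vertices of a long minimal odd closed walk induce no four-cycle. -/
theorem false_of_two_add_two (hG : IsIncomparabilityGraph G) (h : IsOddClosedWalk G n f)
    (hmin : ∀ m g, IsOddClosedWalk G m g → n ≤ m) (hn : 5 ≤ n) {a b c d : ℕ} (ha : a < n)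
    (hb : b < n) (hc : c < n) (hd : d < n) (hab : f a < f b) (hcd : f c < f d)
    (had : ¬ f a < f d) (hcb : ¬ f c < f b) : False := by
  have h1 : G.Adj (f a) (f c) := (hG _ _).2 (by grind [lt_or_eq_of_le])
  have h2 : G.Adj (f c) (f b) := (hG _ _).2 (by grind [lt_or_eq_of_le])
  have h3 : G.Adj (f b) (f d) := (hG _ _).2 (by grind [lt_or_eq_of_le])
  have h4 : G.Adj (f d) (f a) := (hG _ _).2 (by grind [lt_or_eq_of_le])
  have hs : InducesSquare G (f a) (f c) (f b) (f d) := ⟨h1, h2, h3, h4, hab.ne, hcd.ne,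
    fun e => ((hG _ _).1 e).1 hab.le, fun e => ((hG _ _).1 e).1 hcd.le⟩
  have e1 := h.consecutive_of_lt hmin ha hc (Or.inl ⟨_, _, hs⟩)
  have e2 := h.consecutive_of_lt hmin hc hb (Or.inl ⟨_, _, hs.rotate⟩)
  have e3 := h.consecutive_of_lt hmin hb hd (Or.inl ⟨_, _, hs.rotate.rotate⟩)
  have e4 := h.consecutive_of_lt hmin hd ha (Or.inl ⟨_, _, hs.rotate.rotate.rotate⟩)
  have n1 : a ≠ b := fun e => hab.ne (congrArg f e)
  have n2 : c ≠ d := fun e => hcd.ne (congrArg f e)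
  omega

/-- A vertex of the walk with the most vertices above it, together with one of the lowest
vertices above it. -/
theorem exists_extreme_pair (hG : IsIncomparabilityGraph G) (h : IsOddClosedWalk G n f)
    (hmin : ∀ m g, IsOddClosedWalk G m g → n ≤ m) (hn : 5 ≤ n) (hlt : ∃ i j, f i < f j) :
    ∃ i j, i < n ∧ j < n ∧ f i < f j ∧ (∀ k k', f k < f k' → f i < f k') ∧
      ∀ k k', f i < f k' → f k < f j → f k < f k' := by
  classical
  obtain ⟨i₀, j₀, hlt⟩ := hlt
  have hmod := fun i => Nat.mod_lt i h.pos
  let up : ℕ → Finset ℕ := fun i => (Finset.range n).filter fun k => f i < f k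
  let down : ℕ → Finset ℕ := fun i => (Finset.range n).filter fun k => f k < f i
  obtain ⟨i, hi, himax⟩ := Finset.exists_max_image (Finset.range n) (fun i => (up i).card)
    ⟨0, Finset.mem_range.2 h.pos⟩
  rw [Finset.mem_range] at hi
  -- Without a 2+2 the sets of vertices above a given vertex are nested, so the largest contains all
  -- the others; `hdown` is the dual argument.
  have hup : ∀ k < n, ∀ k' < n, f k < f k' → f i < f k' := by
    intro k hk k' hk' hkk
    by_contra hc
    have hss : up i ⊂ up k := by
      refine Finset.ssubset_iff_subset_ne.2 ⟨fun l hl => ?_, fun e => ?_⟩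
      · simp only [up, Finset.mem_filter, Finset.mem_range] at hl ⊢
        refine ⟨hl.1, ?_⟩
        by_contra hkl
        exact false_of_two_add_two hG h hmin hn hk hk' hi hl.1 hkk hl.2 hkl hc
      · have : k' ∈ up k := by simp [up, hk', hkk]
        rw [← e] at this
        simp only [up, Finset.mem_filter] at this
        exact hc this.2
    have := himax k (Finset.mem_range.2 hk)
    exact absurd (Finset.card_lt_card hss) this.not_gt
  have hne : (up i).Nonempty := by
    refine ⟨j₀ % n, ?_⟩
    simp only [up, Finset.mem_filter, Finset.mem_range]
    refine ⟨hmod _, hup (i₀ % n) (hmod _) (j₀ % n) (hmod _) ?_⟩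
    rwa [h.map_mod, h.map_mod]
  obtain ⟨j, hj, hjmin⟩ := Finset.exists_min_image (up i) (fun j => (down j).card) hne
  simp only [up, Finset.mem_filter, Finset.mem_range] at hj
  have hdown : ∀ k < n, ∀ k' < n, f i < f k' → f k < f j → f k < f k' := by
    intro k hk k' hk' hik hkj
    by_contra hc
    have hss : down k' ⊂ down j := by
      refine Finset.ssubset_iff_subset_ne.2 ⟨fun l hl => ?_, fun e => ?_⟩
      · simp only [down, Finset.mem_filter, Finset.mem_range] at hl ⊢
        refine ⟨hl.1, ?_⟩
        by_contra hlj
        exact false_of_two_add_two hG h hmin hn hk hj.1 hl.1 hk' hkj hl.2 hc hlj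
      · have : k ∈ down j := by simp [down, hk, hkj]
        rw [← e] at this
        simp only [down, Finset.mem_filter] at this
        exact hc this.2
    have := hjmin k' (by simp [up, hk', hik])
    exact absurd (Finset.card_lt_card hss) this.not_gt
  refine ⟨i, j, hi, hj.1, hj.2, fun k k' hk => ?_, fun k k' h1 h2 => ?_⟩
  · rw [← h.map_mod k']
    exact hup (k % n) (hmod _) (k' % n) (hmod _) (by rwa [h.map_mod, h.map_mod])
  · rw [← h.map_mod k, ← h.map_mod k']
    exact hdown (k % n) (hmod _) (k' % n) (hmod _) (by rwa [h.map_mod]) (by rwa [h.map_mod])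

theorem false_of_lt_of_five_le (hG : IsIncomparabilityGraph G) (h : IsOddClosedWalk G n f)
    (hmin : ∀ m g, IsOddClosedWalk G m g → n ≤ m) (hn : 5 ≤ n) (hlt : ∃ i j, f i < f j) :
    False := by
  obtain ⟨i, j', hi, hj', hij', N1', N2'⟩ := exists_extreme_pair hG h hmin hn hlt
  obtain ⟨j, h1, h2, hjj⟩ : ∃ j, i < j ∧ j < i + n ∧ f j = f j' := by
    rcases lt_trichotomy i j' with e | rfl | e
    · exact ⟨j', e, by omega, rfl⟩
    · exact (lt_irrefl _ hij').elim
    · exact ⟨j' + n, by omega, by omega, h.periodic _⟩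
  rw [← hjj] at hij' N2'
  have N1 : ∀ k k', f k < f k' → f i < f k' := N1'
  have N2 : ∀ k k', f i < f k' → f k < f j → f k < f k' := N2'
  have hper := h.periodic i
  -- Between `i` and `j` the walk enters the set above `f i` after `k`; between `j` and `i + n` it
  -- leaves it after `l`. Then `f k` and `f (l + 1)` are adjacent to each other and to both `f i`
  -- and `f j`, so they form a diamond diagonal that is a chord of the walk.
  obtain ⟨k, hk1, hk2, hk3, hk4⟩ := Nat.exists_boundary (fun k => ¬ f i < f k) h1.le
    (lt_irrefl _) (by simpa)
  obtain ⟨l, hl1, hl2, hl3, hl4⟩ := Nat.exists_boundary (fun k => f i < f k) h2.le hij'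
    (by rw [hper]; exact lt_irrefl _)
  simp only [not_not] at hk4
  have ak := (hG _ _).1 (h.step k).adj
  have al := (hG _ _).1 (h.step l).adj
  have hki : k ≠ i := by
    rintro rfl
    exact ak.1 hk4.le
  have hli : l + 1 ≠ i + n := by
    intro e
    rw [e, hper] at al
    exact al.2 hl3.le
  have hadj : ∀ m m', ¬ f i < f m → f i < f m' → G.Adj (f m) (f m') → f m ≠ f i →
      G.Adj (f i) (f m) ∧ G.Adj (f m) (f j) := by
    intro m m' hm hm' ham hne
    have ham := (hG _ _).1 ham
    have e1 := N1 m i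
    have e2 := N2 m m' hm'
    constructor
    · refine (hG _ _).2 ?_
      grind [lt_or_eq_of_le]
    · refine (hG _ _).2 ?_
      grind [lt_or_eq_of_le]
  have b1 := hadj k (k + 1) hk3 hk4 (h.step k).adj
    (h.ne_of_minimal hmin (by omega : i < k) (by omega)).symm
  have b2 := hadj (l + 1) l hl4 hl3 (h.step l).adj.symm
    (h.ne_of_minimal hmin (by omega : i < l + 1) (by omega)).symm
  have hne := h.ne_of_minimal hmin (by omega : k < l + 1) (by omega)
  have b3 : G.Adj (f k) (f (l + 1)) := by
    have e1 := N1 k (l + 1)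
    have e2 := N1 (l + 1) k
    refine (hG _ _).2 ?_
    grind [lt_or_eq_of_le]
  have hd : IsDiamondDiagonal G (f k) (f (l + 1)) := ⟨b3, f i, f j, hij'.ne,
    fun e => ((hG _ _).1 e).1 hij'.le, b1.1.symm, b2.1, b2.2, b1.2.symm⟩
  have := h.consecutive_of_minimal hmin (by omega : k < l + 1) (by omega) (Or.inr hd)
  omega

end Incomparability

theorem false_of_four (h : IsOddClosedWalk G 4 f)
    (hs : ∀ i < 4, IsSquareEdge G (f i) (f (i + 1))) : False := by
  have h1 := h.odd
  rw [Finset.sum_congr rfl fun i hi => (hs i (Finset.mem_range.1 hi)).edgeParity_eq] at h1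
  simp only [Finset.sum_const, Finset.card_range] at h1
  revert h1
  decide

/-- Otherwise the chord `f 1`, `f 3` is a diamond diagonal, or all four edges are square edges and
the parity is even. -/
theorem adj_of_four (h : IsOddClosedWalk G 4 f) (hmin : ∀ m g, IsOddClosedWalk G m g → 4 ≤ m) :
    G.Adj (f 0) (f 2) := by
  by_contra hn
  have h4 : f 4 = f 0 := h.periodic 0
  have a0 := (h.step 0).adj
  have a1 := (h.step 1).adj
  have a2 := (h.step 2).adj
  have a3 := (h.step 3).adj
  simp only [zero_add, Nat.reduceAdd, h4] at a0 a1 a2 a3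
  have n1 := h.ne_of_minimal hmin (by omega : 0 < 2) (by omega)
  have n2 := h.ne_of_minimal hmin (by omega : 1 < 3) (by omega)
  by_cases hk : G.Adj (f 1) (f 3)
  · have := h.consecutive_of_minimal hmin (by omega : 1 < 3) (by omega)
      (Or.inr ⟨hk, f 0, f 2, n1, hn, a0.symm, a3.symm, a2.symm, a1.symm⟩)
    omega
  · have hs : InducesSquare G (f 0) (f 1) (f 2) (f 3) := ⟨a0, a1, a2, a3, n1, n2, hn, hk⟩
    refine h.false_of_four fun i hi => ?_
    interval_cases i
    · exact ⟨_, _, hs⟩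
    · exact ⟨_, _, hs.rotate⟩
    · exact ⟨_, _, hs.rotate.rotate⟩
    · simp only [Nat.reduceAdd, h4]
      exact ⟨_, _, hs.rotate.rotate.rotate⟩

/-- The vertices of a minimal odd closed walk form a clique. -/
theorem adj_of_minimal [PartialOrder V] (hG : IsIncomparabilityGraph G)
    (h : IsOddClosedWalk G n f) (hmin : ∀ m g, IsOddClosedWalk G m g → n ≤ m) {i j : ℕ}
    (hij : f i ≠ f j) : G.Adj (f i) (f j) := by
  have hn3 := h.three_le
  rcases Nat.lt_or_ge n 5 with hn | hn
  · have key : ∀ i j, i < j → j < n → G.Adj (f i) (f j) := by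
      intro i j hij hj
      obtain rfl | rfl : n = 3 ∨ n = 4 := by omega
      · have hp : f 3 = f 0 := h.periodic 0
        have a0 := (h.step 0).adj
        have a1 := (h.step 1).adj
        have a2 := (h.step 2).adj
        simp only [zero_add, Nat.reduceAdd, hp] at a0 a1 a2
        obtain ⟨rfl, rfl⟩ | ⟨rfl, rfl⟩ | ⟨rfl, rfl⟩ :
          (i = 0 ∧ j = 1) ∨ (i = 1 ∧ j = 2) ∨ (i = 0 ∧ j = 2) := by omega
        exacts [a0, a1, a2.symm]
      · have hp : f 4 = f 0 := h.periodic 0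
        have a3 := (h.step 3).adj
        simp only [Nat.reduceAdd, hp] at a3
        rcases (by omega : j = i + 1 ∨ j = i + 2 ∨ (i = 0 ∧ j = 3)) with rfl | rfl | ⟨rfl, rfl⟩
        · exact (h.step i).adj
        · exact (h.shift i).adj_of_four hmin
        · exact a3.symm
    have hi := Nat.mod_lt i h.pos
    have hj := Nat.mod_lt j h.pos
    rw [← h.map_mod i, ← h.map_mod j] at hij ⊢
    rcases lt_trichotomy (i % n) (j % n) with e | e | e
    · exact key _ _ e hj
    · exact (hij (congrArg f e)).elim
    · exact (key _ _ e hi).symm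
  · have key := fun h' => false_of_lt_of_five_le hG h hmin hn h'
    refine (hG _ _).2 ⟨fun e => key ⟨i, j, lt_of_le_of_ne e hij⟩,
      fun e => key ⟨j, i, lt_of_le_of_ne e hij.symm⟩⟩

/-- In a minimal odd closed walk the least and the greatest vertex are not consecutive, if the
edge between them lies on an induced four-cycle. -/
theorem false_of_extremes [PartialOrder V] (hG : IsOrderComparabilityGraph G)
    (H : SquaresUnrelated G) (h : IsOddClosedWalk G n f)
    (hmin : ∀ m g, IsOddClosedWalk G m g → n ≤ m)
    (hz : ∀ i, f 0 ≤ f i) (hZ : ∀ i, f i ≤ f 1) (hs : IsSquareEdge G (f 0) (f 1)) : False := by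
  have hn := h.three_le
  have hne : ∀ i j, i < j → j < i + n → f i ≠ f j := fun i j => h.ne_of_minimal hmin
  have l02 : f 0 < f 2 := lt_of_le_of_ne (hz 2) (hne 0 2 (by omega) (by omega))
  have l21 : f 2 < f 1 := lt_of_le_of_ne (hZ 2) (hne 1 2 (by omega) (by omega)).symm
  have c1 := h.step 1
  have c2 := h.step 2
  simp only [Nat.reduceAdd] at c1 c2
  rcases Nat.lt_or_ge n 4 with hn4 | hn4
  · obtain rfl : n = 3 := by omega
    have hp : f 3 = f 0 := h.periodic 0
    have ho := h.odd
    rw [hp] at c2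
    simp only [Finset.sum_range_succ, Finset.sum_range_zero, zero_add, Nat.reduceAdd, hp] at ho
    -- In a triangle, parity excludes the mixed cases. Two square edges give a second vertex `b`
    -- below `f 2`, making `f 2`, `f 1` a diamond diagonal; two diamond diagonals relate `f 0` and
    -- `f 1`.
    rcases c1 with c1 | c1 <;> rcases c2 with c2 | c2
    · obtain ⟨w, b, hsq⟩ := c2
      obtain ⟨d1, d2, d3, d4, d5, d6, d7, d8⟩ := hsq.reverse
      have hb : b < f 2 := by
        rw [hG] at d1 d2 d3 d4 d7 d8
        grind
      exact c1.not_isDiamondDiagonal H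
        (isDiamondDiagonal_of_above hG l21 d5 d7 l02 hb).symm
    · rw [hs.edgeParity_eq, c1.edgeParity_eq,
        edgeParity_eq_zero fun e => e.not_isDiamondDiagonal H c2] at ho
      revert ho
      decide
    · rw [hs.edgeParity_eq, c2.edgeParity_eq,
        edgeParity_eq_zero fun e => e.not_isDiamondDiagonal H c1] at ho
      revert ho
      decide
    · obtain ⟨z, w, hsq⟩ := hs
      exact (H _ _ _ _ hsq).1 (c1.diamondRelated.trans c2.diamondRelated).symm
  · have l03 : f 0 < f 3 := lt_of_le_of_ne (hz 3) (hne 0 3 (by omega) (by omega))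
    have l31 : f 3 < f 1 := lt_of_le_of_ne (hZ 3) (hne 1 3 (by omega) (by omega)).symm
    have k02 : ¬ IsConstrained G (f 0) (f 2) := fun e => by
      have := h.consecutive_of_minimal hmin (by omega : 0 < 2) (by omega) e
      omega
    have k13 : ¬ IsConstrained G (f 3) (f 1) := fun e => by
      have := h.consecutive_of_minimal hmin (by omega : 1 < 3) (by omega) e.symm
      omega
    -- A constrained edge `f 2`, `f 3` between the extremes yields a constrained chord, a diamond
    -- diagonal `f 0`, `f 1`, or four square edges.
    rcases (hG _ _).1 c2.adj with l23 | l32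
    · rcases c2 with c2 | c2
      · have e1 := c2.lt_trans hG H l23 l02
        have e2 := c2.trans_lt hG H l23 l31
        have := h.consecutive_of_minimal hmin (by omega : 0 < 3) (by omega) (Or.inl e1)
        obtain rfl : n = 4 := by omega
        have hp : f 4 = f 0 := h.periodic 0
        refine h.false_of_four fun i hi => ?_
        interval_cases i
        · exact hs
        · exact e2.symm
        · exact c2
        · simp only [Nat.reduceAdd, hp]
          exact e1.symm
      · obtain ⟨a, b, hab, hn, ⟨h1, h2⟩ | ⟨h1, h2⟩ | ⟨h1, h2, h3, h4⟩⟩ := c2.position hG l23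
        · exact k02 (Or.inr (isDiamondDiagonal_of_below hG l02 hab hn (l23.trans h1)
            (l23.trans h2)))
        · exact k13 (Or.inr (isDiamondDiagonal_of_above hG l31 hab hn (h1.trans l23)
            (h2.trans l23)))
        · exact hs.not_isDiamondDiagonal H (isDiamondDiagonal_of_between hG hab hn
            (l02.trans h1) (l02.trans h2) (h3.trans l31) (h4.trans l31))
    · rcases c2.symm.extend hG H l32 l03 l21 with e | e
      exacts [k02 e, k13 e]

/-- A minimal odd closed walk cannot be a chain. -/
theorem false_of_clique [PartialOrder V] (hG : IsOrderComparabilityGraph G)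
    (H : SquaresUnrelated G) (h : IsOddClosedWalk G n f)
    (hmin : ∀ m g, IsOddClosedWalk G m g → n ≤ m)
    (hc : ∀ i j, f i ≠ f j → G.Adj (f i) (f j)) : False := by
  have hpos := h.pos
  have hne : (f '' (Finset.range n : Set ℕ)).Nonempty := ⟨f 0, 0, by simpa using hpos, rfl⟩
  have hfin : (f '' (Finset.range n : Set ℕ)).Finite := (Finset.finite_toSet _).image f
  obtain ⟨z, ⟨⟨i, hi, rfl⟩, hzmin⟩⟩ := hfin.exists_minimal hne
  obtain ⟨Z, ⟨⟨j, hj, rfl⟩, hZmax⟩⟩ := hfin.exists_maximal hne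
  simp only [Finset.coe_range, Set.mem_Iio] at hi hj
  have hmem : ∀ k, f k ∈ f '' (Finset.range n : Set ℕ) := fun k =>
    ⟨k % n, by simpa using Nat.mod_lt k hpos, h.map_mod k⟩
  have htot : ∀ k l, f k ≤ f l ∨ f l ≤ f k := by
    intro k l
    by_cases e : f k = f l
    · exact Or.inl e.le
    · exact ((hG _ _).1 (hc k l e)).imp le_of_lt le_of_lt
  have hz : ∀ k, f i ≤ f k := fun k => (htot i k).elim id fun e => hzmin (hmem k) e
  have hZ : ∀ k, f k ≤ f j := fun k => (htot k j).elim id fun e => hZmax (hmem k) e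
  have hred : ∃ k, IsSquareEdge G (f k) (f (k + 1)) := by
    by_contra! hno
    have := h.odd
    rw [Finset.sum_eq_zero fun k _ => edgeParity_eq_zero (hno k)] at this
    exact zero_ne_one this
  -- Odd parity provides a square edge, and square edges extend down to the minimum and up to the
  -- maximum.
  have hext : ∀ k l, f k < f l → IsSquareEdge G (f k) (f l) → IsSquareEdge G (f i) (f j) := by
    intro k l hkl he
    have h1 : IsSquareEdge G (f i) (f l) := by
      rcases (hz k).lt_or_eq with e | e
      · exact he.lt_trans hG H hkl e
      · rwa [e]
    rcases (hZ l).lt_or_eq with e | e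
    · exact h1.trans_lt hG H ((hz k).trans_lt hkl) e
    · rwa [← e]
  have hzZ : IsSquareEdge G (f i) (f j) := by
    obtain ⟨k, hk⟩ := hred
    rcases (hG _ _).1 (h.step k).adj with e | e
    · exact hext _ _ e hk
    · exact hext _ _ e hk.symm
  have hcase : f (i + 1) = f j ∨ f (j + 1) = f i := by
    have := h.consecutive_of_lt hmin hi hj (Or.inl hzZ)
    rcases this with e | e | e | e
    · exact Or.inl (by rw [e])
    · exact Or.inr (by rw [e])
    · exact Or.inr (by rw [e, h.periodic])
    · exact Or.inl (by rw [e, h.periodic])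
  rcases hcase with e | e
  · refine false_of_extremes hG H (h.shift i) hmin (fun k => hz _) (fun k => ?_) ?_
    · rw [e]
      exact hZ _
    · rw [e]
      exact hzZ
  · refine @false_of_extremes V G n _ (OrderDual.instPartialOrder V) hG.dual H (h.shift j) hmin
      (fun k => hZ _) (fun k => ?_) ?_
    · rw [e]
      exact hz _
    · rw [e]
      exact hzZ.symm

end IsOddClosedWalk

/-! ### The two orders and the conclusion -/

theorem exists_isDirectionColouring {V : Type*} {G : SimpleGraph V} (P Q : PartialOrder V)
    (hP : @IsIncomparabilityGraph V P G) (hQ : @IsOrderComparabilityGraph V Q G)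
    (H : SquaresUnrelated G) : ∃ f, IsDirectionColouring G f := by
  classical
  refine exists_isDirectionColouring_of_forall_not H fun n f h => ?_
  have hex : ∃ n, ∃ f, IsOddClosedWalk G n f := ⟨n, f, h⟩
  obtain ⟨g, hg⟩ := Nat.find_spec hex
  have hmin : ∀ m g, IsOddClosedWalk G m g → Nat.find hex ≤ m := fun m g hm =>
    Nat.find_min' hex ⟨g, hm⟩
  exact hg.false_of_clique hQ H hmin fun i j hij =>
    @IsOddClosedWalk.adj_of_minimal V G _ g P hP hg hmin i j hij

/-- The two linear orders realizing a permutation graph also give a transitive orientation of its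
complement. -/
theorem IsPermutationGraph.exists_orders {V : Type*} {G : SimpleGraph V}
    (hG : IsPermutationGraph G) : ∃ P Q : PartialOrder V,
      @IsIncomparabilityGraph V P G ∧ @IsOrderComparabilityGraph V Q G := by
  obtain ⟨Q, rfl, k, hk, L, hL⟩ := hG
  rcases isEmpty_or_nonempty V with hV | ⟨⟨v⟩⟩
  · exact ⟨Q, Q, fun x => (hV.false x).elim, fun x => (hV.false x).elim⟩
  obtain ⟨A, B, hAB⟩ : ∃ A B : LinearOrder V, ∀ x y, Q.lt x y ↔ A.lt x y ∧ B.lt x y := by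
    -- An empty intersection would relate `v` to itself; a single order is used twice.
    obtain rfl | rfl | rfl : k = 0 ∨ k = 1 ∨ k = 2 := by omega
    · exact (lt_irrefl v ((hL v v).2 fun i => i.elim0)).elim
    · exact ⟨L 0, L 0, fun x y => by rw [hL]; simp⟩
    · exact ⟨L 0, L 1, fun x y => by rw [hL, Fin.forall_fin_two]⟩
  -- Reversing `B` makes comparable exactly the pairs on which `A` and `B` disagree.
  let P : PartialOrder V :=
    { le := fun x y => A.le x y ∧ B.le y x
      lt := fun x y => (A.le x y ∧ B.le y x) ∧ ¬ (A.le y x ∧ B.le x y)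
      lt_iff_le_not_ge := fun x y => Iff.rfl
      le_refl := fun x => ⟨A.le_refl x, B.le_refl x⟩
      le_trans := fun x y z h1 h2 => ⟨A.le_trans _ _ _ h1.1 h2.1, B.le_trans _ _ _ h2.2 h1.2⟩
      le_antisymm := fun x y h1 h2 => A.le_antisymm _ _ h1.1 h2.1 }
  refine ⟨P, Q, fun x y => ?_, fun x y => Iff.rfl⟩
  change Q.lt x y ∨ Q.lt y x ↔ ¬ (A.le x y ∧ B.le y x) ∧ ¬ (A.le y x ∧ B.le x y)
  rw [hAB, hAB, ← @not_le V A y x, ← @not_le V A x y, ← @not_le V B y x, ← @not_le V B x y]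
  have h1 := A.le_total x y
  have h2 := B.le_total x y
  have h3 : (A.le x y ∧ A.le y x) ↔ (B.le x y ∧ B.le y x) := by
    constructor
    · rintro ⟨h, h'⟩
      obtain rfl := A.le_antisymm x y h h'
      exact ⟨B.le_refl x, B.le_refl x⟩
    · rintro ⟨h, h'⟩
      obtain rfl := B.le_antisymm x y h h'
      exact ⟨A.le_refl x, A.le_refl x⟩
  generalize A.le x y = p, A.le y x = p', B.le x y = q, B.le y x = q' at *
  by_cases p <;> by_cases p' <;> by_cases q <;> by_cases q' <;> simp_all

theorem corollary1 {V : Type*} [Finite V] (G : SimpleGraph V) (hG : IsPermutationGraph G) :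
    IsBkVPG 0 G ↔
      ∀ (c : SimpleGraph.cycleGraph 4 ↪g G) (i j : Fin 4), i ≠ j →
        ¬ DiamondRelated G (c i) (c j) := by
  rw [isBkVPG_zero_iff_hasSegmentRep, forall_cycleGraph_embedding_iff]
  constructor
  · exact fun h x y z w hs => hs.not_diamondRelated h
  · intro H
    obtain ⟨P, Q, hP, hQ⟩ := hG.exists_orders
    obtain ⟨f, hf⟩ := exists_isDirectionColouring P Q hP hQ H
    exact @IsDirectionColouring.hasSegmentRep V P G f _ hP hf
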